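/- Let $p$ be a prime, let $\lambda\in\mathbb{Z}_p$ be a $p$-adic unit, and let $S$ be an abelian semigroup with a total order. Let $\mathrm{Sh}(S)=\mathrm{Sh}_{\mathbb{Z}_p,\lambda}(S)$ be the mixable shuffle algebra of weight $\lambda$: the free $\mathbb{Z}_p$-module on the set of all words (finite sequences) $u_1\otimes\cdots\otimes u_r$, $r\ge 0$, with letters in $S$, with the bilinear commutative product $*$ whose unit is the empty word and which satisfies, for letters $a,b\in S$ and words $u,v$, $$(a\otimes u)*(b\otimes v)=a\otimes\big(u*(b\otimes v)\big)+b\otimes\big((a\otimes u)*v\big)+\lambda\,(ab)\otimes(u*v).$$ Notation. Let $\ell(w)$ be the length of a word $w$. For $w=u_1\otimes\cdots\otimes u_r$ put $w^{(p)}=u_1^p\otimes\cdots\otimes u_r^p$. Let $\mathrm{Lyn}=\mathrm{Lyn}(S)$ be the set of Lyndon words: nonempty words $w$ with $w<v$ in the lexicographic order (a proper prefix of a word being smaller than the word) whenever $w=u\otimes v$ with $u,v$ nonempty. For a set $W$ of words let $$\mathrm T(W)=\{w^{\otimes p^i}: w\in W,\ i\ge 0\},\qquad \mathrm E(W)=\{w\in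 W: w=w^{(p)},\text{ or } w\ne u^{(p)}\text{ for every word }u\},$$ $W_1=\{w\in W:w^{(p)}=w\}$ and $W_2=\{w\in W:w^{(p)}\neq w\}$. Put $\mathrm{TEL}=\mathrm T(\mathrm E(\mathrm{Lyn}))$ and $\mathrm{TL}_i=\mathrm T(\mathrm{Lyn}_i)$ for $i=1,2$. For a set $Y$ with an inclusion map $Y\to \mathrm{Sh}(S)$, $\mathbb{Z}_p[Y]$ denotes the polynomial algebra on a set of variables $\hat y$ indexed by $Y$, and the natural homomorphism $\phi:\mathbb{Z}_p[Y]\to\mathrm{Sh}(S)$ sends $\hat y$ to $y$. (1) Let $S$ be the free abelian semigroup on a finite totally ordered set $X$ (the monomials in $X$ other than $1$), ordered first by total degree and then by the lexicographic order of exponent vectors. Let the degree of a word be the sum of the total degrees of its letters, and let $\mathrm{Sh}(S)^{(n)}$, $\mathrm{TEL}^{(n)}$ and $\mathrm{Lyn}(S)^{(n)}$ be the span of the words of degree $n$, and the sets of words of degree $n$ in $\mathrm{TEL}$ and in $\mathrm{Lyn}(S)$. Then $\mathrm{Sh}(S)=\bigoplus_{n\ge0}\mathrm{Sh}(S)^{(n)}$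 is a graded algebra, and the natural homomorphism $$\phi:\mathbb{Z}_p[\mathrm{TEL}]\to \mathrm{Sh}(S)$$ is an isomorphism of graded $\mathbb{Z}_p$-algebras, where $\hat w$ has the degree of $w$. In particular, for every $n\ge1$, sending $w$ to its class gives an isomorphism of $\mathbb{Z}_p$-modules from the free module on $\mathrm{TEL}^{(n)}$, $$\mathbb{Z}_p\,\mathrm{TEL}^{(n)}\;\cong\;\mathrm{Sh}(S)^{(n)}\Big/\Big(\sum_{i=1}^{n-1}\mathrm{Sh}(S)^{(i)}*\mathrm{Sh}(S)^{(n-i)}\Big).$$ Further, for every $n\ge1$, the sets $\mathrm{TEL}^{(n)}$ and $\mathrm{Lyn}(S)^{(n)}$ are finite and have the same cardinality. (2) Let $S$ be a well-ordered abelian semigroup (no compatibility of the order with the product is required) such that $g^{p^2}=g^p$ for all $g\in S$, and $g_1<g_2$ whenever $g_1^p=g_1$ and $g_2^p\ne g_2$. Let $\overline{\mathrm{E}}\mathrm{TL}_2=\{w-w^{(p)}: w\in \mathrm{TL}_2\}$ and $\overline{\mathrm{E}}\mathrm{TL}=\mathrm{TL}_1\cup\overline{\mathrm{E}}\mathrm{TL}_2\subseteq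 \mathrm{Sh}(S)$, and let $\phi:\mathbb{Z}_p[\overline{\mathrm{E}}\mathrm{TL}]\to\mathrm{Sh}(S)$ be the natural homomorphism. Then there are families of polynomials $Q'_v$ ($v\in\mathrm{TL}_1$) and $Q'_x$ ($x\in\overline{\mathrm{E}}\mathrm{TL}_2$) in $\mathbb{Z}_p[\overline{\mathrm{E}}\mathrm{TL}]$ with $$\phi(\hat v)^{p}-\lambda^{(\ell(v)-1)(p-1)}\phi(\hat v)=p\,\phi(Q'_v),\qquad \phi(\hat x)^{p}=p\,\phi(Q'_x)$$ for all $v$ and $x$. For every choice of such families, let $I$ be the ideal of $\mathbb{Z}_p[\overline{\mathrm{E}}\mathrm{TL}]$ generated by all $\hat v^{p}-\lambda^{(\ell(v)-1)(p-1)}\hat v-pQ'_v$ and all $\hat x^{p}-pQ'_x$, and let $\bar I=\bigcap_{n\ge0}\big(I+p^n\mathbb{Z}_p[\overline{\mathrm{E}}\mathrm{TL}]\big)$ be its $p$-adic closure. Then $\phi$ vanishes on $\bar I$, and the induced homomorphism $$\mathbb{Z}_p[\overline{\mathrm{E}}\mathrm{TL}]/\bar I\to \mathrm{Sh}(S)$$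 is an isomorphism of $\mathbb{Z}_p$-algebras. -/

import Mathlib

noncomputable section

namespace MixShuffle

open MvPolynomial

section Product

variable {k : Type*} [CommRing k] {S : Type*}

/-- The linear map `w ↦ a ⊗ w` on the free module on words. -/
def prepend (a : S) : (List S →₀ k) →ₗ[k] (List S →₀ k) :=
  Finsupp.lmapDomain k k (List.cons a)

/-- The mixable shuffle product of weight `lam` of two words: the empty word is the unit and
`(a ⊗ u) * (b ⊗ v) = a ⊗ (u * (b ⊗ v)) + b ⊗ ((a ⊗ u) * v) + lam (ab) ⊗ (u * v)`. -/
def mulWord [Mul S] (lam : k) : List S → List S → (List S →₀ k)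
  | [], v => Finsupp.single v 1
  | a :: u, [] => Finsupp.single (a :: u) 1
  | a :: u, b :: v =>
      prepend a (mulWord lam u (b :: v)) + prepend b (mulWord lam (a :: u) v)
        + lam • prepend (a * b) (mulWord lam u v)
termination_by u v => u.length + v.length

/-- The bilinear extension of `mulWord`. -/
def mulLin [Mul S] (lam : k) : (List S →₀ k) →ₗ[k] (List S →₀ k) →ₗ[k] (List S →₀ k) :=
  Finsupp.linearCombination k fun u => Finsupp.linearCombination k fun v => mulWord lam u v

theorem prepend_single (a : S) (w : List S) (c : k) :
    prepend a (Finsupp.single w c) = Finsupp.single (a :: w) c := by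
  simp [prepend]

theorem mulLin_single [Mul S] (lam : k) (u v : List S) :
    mulLin lam (Finsupp.single u 1) (Finsupp.single v 1) = mulWord lam u v := by
  simp [mulLin]

theorem mulWord_nil_right [Mul S] (lam : k) (u : List S) :
    mulWord lam u [] = Finsupp.single u 1 := by
  cases u <;> simp [mulWord]

theorem mulWord_comm [CommSemigroup S] (lam : k) (u v : List S) :
    mulWord lam u v = mulWord lam v u := by
  match u, v with
  | [], v => rw [mulWord_nil_right, mulWord]
  | a :: u, [] => simp [mulWord]
  | a :: u, b :: v =>
    rw [mulWord, mulWord, mulWord_comm lam u (b :: v), mulWord_comm lam (a :: u) v,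
      mulWord_comm lam u v, mul_comm a b]
    abel
termination_by u.length + v.length

/-- Two linear maps that agree on words agree. -/
theorem ext_words {M : Type*} [AddCommGroup M] [Module k M] {f g : (List S →₀ k) →ₗ[k] M}
    (h : ∀ w, f (Finsupp.single w 1) = g (Finsupp.single w 1)) (x : List S →₀ k) :
    f x = g x := by
  have : f = g := Finsupp.lhom_ext' fun w => LinearMap.ext_ring (h w)
  rw [this]

theorem mulLin_nil_left [Mul S] (lam : k) (x : List S →₀ k) :
    mulLin lam (Finsupp.single [] 1) x = x :=
  ext_words (f := mulLin lam (Finsupp.single [] 1)) (g := LinearMap.id)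
    (fun w => by rw [mulLin_single, mulWord, LinearMap.id_apply]) x

theorem mulLin_comm [CommSemigroup S] (lam : k) (x y : List S →₀ k) :
    mulLin lam x y = mulLin lam y x := by
  have h : ∀ u, mulLin lam (Finsupp.single u 1) y = mulLin lam y (Finsupp.single u 1) := fun u =>
    ext_words (f := mulLin lam (Finsupp.single u 1))
      (g := (mulLin lam).flip (Finsupp.single u 1))
      (fun w => by
        rw [LinearMap.flip_apply, mulLin_single, mulLin_single, mulWord_comm]) y
  exact ext_words (f := (mulLin lam).flip y) (g := mulLin lam y)
    (fun w => by rw [LinearMap.flip_apply, h]) x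

theorem mulLin_prepend [Mul S] (lam : k) (a b : S) (x y : List S →₀ k) :
    mulLin lam (prepend a x) (prepend b y) =
      prepend a (mulLin lam x (prepend b y)) + prepend b (mulLin lam (prepend a x) y)
        + lam • prepend (a * b) (mulLin lam x y) := by
  induction x using Finsupp.induction_linear with
  | zero => simp
  | add f g hf hg => simp only [map_add, LinearMap.add_apply, hf, hg, smul_add]; abel
  | single u c =>
    induction y using Finsupp.induction_linear with
    | zero => simp
    | add f g hf hg => simp only [map_add, hf, hg, smul_add]; abel
    | single v d =>
      rw [← mul_one c, ← mul_one d, ← smul_eq_mul, ← smul_eq_mul, ← Finsupp.smul_single,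
        ← Finsupp.smul_single]
      simp only [map_smul, LinearMap.smul_apply, prepend_single, mulLin_single]
      rw [mulWord]
      simp only [smul_add, smul_comm lam]

theorem mulLin_assoc_word [CommSemigroup S] (lam : k) (u v w : List S) :
    mulLin lam (mulLin lam (Finsupp.single u 1) (Finsupp.single v 1)) (Finsupp.single w 1) =
      mulLin lam (Finsupp.single u 1)
        (mulLin lam (Finsupp.single v 1) (Finsupp.single w 1)) := by
  match u, v, w with
  | [], v, w => rw [mulLin_nil_left, mulLin_nil_left]
  | a :: u, [], w =>
    rw [mulLin_nil_left, mulLin_comm lam (Finsupp.single (a :: u) 1), mulLin_nil_left]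
  | a :: u, b :: v, [] =>
    rw [mulLin_comm lam _ (Finsupp.single [] 1), mulLin_nil_left,
      mulLin_comm lam _ (Finsupp.single [] 1), mulLin_nil_left]
  | a :: u, b :: v, c :: w =>
    have h1 := mulLin_assoc_word lam u (b :: v) (c :: w)
    have h2 := mulLin_assoc_word lam (a :: u) v (c :: w)
    have h3 := mulLin_assoc_word lam (a :: u) (b :: v) w
    have h4 := mulLin_assoc_word lam u v (c :: w)
    have h5 := mulLin_assoc_word lam u (b :: v) w
    have h6 := mulLin_assoc_word lam (a :: u) v w
    have h7 := mulLin_assoc_word lam u v w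
    simp only [← prepend_single] at *
    generalize Finsupp.single u (1 : k) = x at *
    generalize Finsupp.single v (1 : k) = y at *
    generalize Finsupp.single w (1 : k) = z at *
    simp only [mulLin_prepend lam b c y z, map_add, map_smul] at h1
    simp only [mulLin_prepend lam a b x y, map_add, map_smul, LinearMap.add_apply,
      LinearMap.smul_apply] at h3
    have e1 := congrArg (prepend a) h1
    have e2 := congrArg (prepend b) h2
    have e3 := congrArg (prepend c) h3
    have e4 := congrArg (fun t => lam • prepend (a * b) t) h4
    have e5 := congrArg (fun t => lam • prepend (a * c) t) h5
    have e6 := congrArg (fun t => lam • prepend (b * c) t) h6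
    have e7 := congrArg (fun t => lam • lam • prepend (a * (b * c)) t) h7
    simp only [map_add, map_smul] at e1 e3
    simp only [mulLin_prepend, map_add, map_smul, LinearMap.add_apply, LinearMap.smul_apply,
      smul_add, mul_assoc]
    linear_combination (norm := module) e1 + e2 + e3 + e4 + e5 + e6 + e7
termination_by u.length + v.length + w.length

end Product

section Algebra

variable {k : Type*} [CommRing k]

/-- The mixable shuffle algebra of weight `lam` with coefficients in `k` on the semigroup `S`:
the free `k`-module on all words with letters in `S`, with the mixable shuffle product. -/
def Sh (_lam : k) (S : Type*) : Type _ := List S →₀ k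

variable {lam : k} {S : Type*}

instance : AddCommGroup (Sh lam S) := inferInstanceAs (AddCommGroup (List S →₀ k))

instance : Module k (Sh lam S) := inferInstanceAs (Module k (List S →₀ k))

/-- A word as an element of the mixable shuffle algebra. -/
def word (lam : k) (w : List S) : Sh lam S := (Finsupp.single w 1 : List S →₀ k)

theorem mulLin_assoc [CommSemigroup S] (lam : k) (x y z : List S →₀ k) :
    mulLin lam (mulLin lam x y) z = mulLin lam x (mulLin lam y z) := by
  have h1 : ∀ u v, mulLin lam (mulLin lam (Finsupp.single u 1) (Finsupp.single v 1)) z =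
      mulLin lam (Finsupp.single u 1) (mulLin lam (Finsupp.single v 1) z) := fun u v =>
    ext_words (f := mulLin lam (mulLin lam (Finsupp.single u 1) (Finsupp.single v 1)))
      (g := mulLin lam (Finsupp.single u 1) ∘ₗ mulLin lam (Finsupp.single v 1))
      (fun w => mulLin_assoc_word lam u v w) z
  have h2 : ∀ u, mulLin lam (mulLin lam (Finsupp.single u 1) y) z =
      mulLin lam (Finsupp.single u 1) (mulLin lam y z) := fun u =>
    ext_words (f := (mulLin lam).flip z ∘ₗ mulLin lam (Finsupp.single u 1))
      (g := mulLin lam (Finsupp.single u 1) ∘ₗ (mulLin lam).flip z)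
      (fun v => h1 u v) y
  exact ext_words (f := (mulLin lam).flip z ∘ₗ (mulLin lam).flip y)
      (g := (mulLin lam).flip (mulLin lam y z)) (fun u => h2 u) x

variable [CommSemigroup S]

instance : CommRing (Sh lam S) :=
  { (inferInstance : AddCommGroup (Sh lam S)) with
    mul := fun x y => mulLin lam x y
    one := word lam []
    left_distrib := fun x y z => (mulLin lam x).map_add y z
    right_distrib := fun x y z => (mulLin lam).map_add₂ x y z
    zero_mul := fun x => (mulLin lam).map_zero₂ x
    mul_zero := fun x => (mulLin lam x).map_zero
    mul_assoc := mulLin_assoc lam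
    one_mul := mulLin_nil_left lam
    mul_one := fun x => (mulLin_comm lam x _).trans (mulLin_nil_left lam x)
    mul_comm := mulLin_comm lam }

instance : Algebra k (Sh lam S) :=
  Algebra.ofModule (fun r x y => (mulLin lam).map_smul₂ r x y)
    (fun r x y => (mulLin lam x).map_smul r y)

end Algebra

section Words

variable {S : Type*}

/-- The power `g ^ n` in a semigroup, for `n ≥ 1`. -/
def sgPow [Mul S] (g : S) (n : ℕ) : S := (fun x => x * g)^[n - 1] g

/-- `w = u₁ ⊗ ⋯ ⊗ uᵣ ↦ u₁ᵖ ⊗ ⋯ ⊗ uᵣᵖ`. -/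
def letterPow [Mul S] (p : ℕ) (w : List S) : List S := w.map fun g => sgPow g p

/-- The concatenation power `w ⊗ ⋯ ⊗ w` (`n` factors). -/
def tensorPow (w : List S) (n : ℕ) : List S := (List.replicate n w).flatten

/-- The Lyndon words: nonempty words that are lexicographically smaller than all their proper
nonempty right factors (a proper prefix of a word is smaller than the word). -/
def Lyn (S : Type*) [LinearOrder S] : Set (List S) :=
  {w | w ≠ [] ∧ ∀ u v, u ≠ [] → v ≠ [] → w = u ++ v → List.Lex (· < ·) w v}

/-- The words in `W` with `letterPow p w = w`. -/
def fixedPart [Mul S] (p : ℕ) (W : Set (List S)) : Set (List S) := {w ∈ W | letterPow p w = w}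

/-- The words in `W` with `letterPow p w ≠ w`. -/
def movedPart [Mul S] (p : ℕ) (W : Set (List S)) : Set (List S) := {w ∈ W | letterPow p w ≠ w}

/-- The operator `E`. -/
def opE [Mul S] (p : ℕ) (W : Set (List S)) : Set (List S) :=
  {w ∈ W | w = letterPow p w ∨ ∀ u : List S, w ≠ letterPow p u}

/-- The operator `T`. -/
def opT (p : ℕ) (W : Set (List S)) : Set (List S) :=
  {v | ∃ w ∈ W, ∃ i : ℕ, v = tensorPow w (p ^ i)}

/-- The set `TEL` for `L` the set of Lyndon words. -/
def TEL (p : ℕ) (S : Type*) [Mul S] [LinearOrder S] : Set (List S) := opT p (opE p (Lyn S))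

/-- The set `TL₁`. -/
def TL₁ (p : ℕ) (S : Type*) [Mul S] [LinearOrder S] : Set (List S) :=
  opT p (fixedPart p (Lyn S))

/-- The set `TL₂`. -/
def TL₂ (p : ℕ) (S : Type*) [Mul S] [LinearOrder S] : Set (List S) :=
  opT p (movedPart p (Lyn S))

end Words

section Free

/-- The free abelian semigroup on `X`: monomials `∏ x ^ (n x)` with not all exponents zero. -/
def FreeAbSemigroup (X : Type*) : Type _ := {f : X →₀ ℕ // f ≠ 0}

variable {X : Type*}

instance : CommSemigroup (FreeAbSemigroup X) where
  mul f g := ⟨f.1 + g.1, fun h => f.2 (by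
    ext x
    have := DFunLike.congr_fun h x
    simp only [Finsupp.add_apply, Finsupp.zero_apply] at this ⊢
    omega)⟩
  mul_assoc f g h := Subtype.ext (add_assoc f.1 g.1 h.1)
  mul_comm f g := Subtype.ext (add_comm f.1 g.1)

/-- The degree-lexicographic order: first by total degree, then by the lexicographic order of the
exponent vectors. -/
instance [LinearOrder X] : LinearOrder (FreeAbSemigroup X) :=
  LinearOrder.lift' (fun f => toDegLex f.1) fun _ _ h => Subtype.ext (toDegLex_injective h)

/-- Total degree of a monomial. -/
def FreeAbSemigroup.deg (f : FreeAbSemigroup X) : ℕ := f.1.degree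

/-- Degree of a word: the sum of the degrees of its letters. -/
def wordDeg (w : List (FreeAbSemigroup X)) : ℕ := (w.map FreeAbSemigroup.deg).sum

variable {k : Type*} [CommRing k]

/-- The homogeneous component of degree `n` of the mixable shuffle algebra. -/
def degPart (lam : k) (X : Type*) (n : ℕ) : Submodule k (Sh lam (FreeAbSemigroup X)) :=
  Submodule.span k {x | ∃ w : List (FreeAbSemigroup X), wordDeg w = n ∧ x = word lam w}

/-- The submodule `∑_{0 < i < n} Sh^(i) Sh^(n - i)`. -/
def decomposables (lam : k) (X : Type*) (n : ℕ) : Submodule k (Sh lam (FreeAbSemigroup X)) :=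
  ⨆ i ∈ Finset.Ico 1 n, degPart lam X i * degPart lam X (n - i)

/-- The degree `n` part of `Lyn`. -/
def LynDeg (X : Type*) [LinearOrder X] (n : ℕ) : Set (List (FreeAbSemigroup X)) :=
  {w ∈ Lyn (FreeAbSemigroup X) | wordDeg w = n}

/-- The degree `n` part of `TEL`. -/
def TELDeg (p : ℕ) (X : Type*) [LinearOrder X] (n : ℕ) : Set (List (FreeAbSemigroup X)) :=
  {w ∈ TEL p (FreeAbSemigroup X) | wordDeg w = n}

/-- The natural homomorphism `k[TEL] → Sh(S)`, sending the variable of a word to the word. -/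
def phiTEL (p : ℕ) (lam : k) (X : Type*) [LinearOrder X] :
    MvPolynomial (TEL p (FreeAbSemigroup X)) k →ₐ[k] Sh lam (FreeAbSemigroup X) :=
  aeval fun w => word lam w.1

/-- The natural linear map from the free module on `TEL^(n)` to the quotient of `Sh^(n)` by the
decomposable elements. -/
def toIndecomposables (p : ℕ) (lam : k) (X : Type*) [LinearOrder X] (n : ℕ) :
    (TELDeg p X n →₀ k) →ₗ[k]
      (degPart lam X n ⧸ (decomposables lam X n).submoduleOf (degPart lam X n)) :=
  Finsupp.linearCombination k fun w =>
    Submodule.Quotient.mk ⟨word lam w.1, Submodule.subset_span ⟨w.1, w.2.2, rfl⟩⟩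

end Free

section ClassJ

/-- The class of well-ordered abelian semigroups such that `g ^ (p ^ 2) = g ^ p` for all `g`, and
such that every `g` with `g ^ p = g` is smaller than every `g` with `g ^ p ≠ g`. No compatibility
of the order with the product is required. -/
structure IsClassJ (p : ℕ) (S : Type*) [CommSemigroup S] [LinearOrder S] : Prop where
  wellOrdered : WellFoundedLT S
  pow_sq : ∀ g : S, sgPow g (p ^ 2) = sgPow g p
  lt : ∀ g₁ g₂ : S, sgPow g₁ p = g₁ → sgPow g₂ p ≠ g₂ → g₁ < g₂

variable (p : ℕ) {k : Type*} [CommRing k] (lam : k) (S : Type*) [CommSemigroup S] [LinearOrder S]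

/-- The set of the differences `w - w^(p)`, `w ∈ TL₂`. -/
def EETL₂ : Set (Sh lam S) := {x | ∃ w ∈ TL₂ p S, x = word lam w - word lam (letterPow p w)}

/-- The union of `TL₁` and `EETL₂`, as a subset of the mixable shuffle algebra. -/
def EETL : Set (Sh lam S) := word lam '' TL₁ p S ∪ EETL₂ p lam S

/-- The natural homomorphism from the polynomial algebra on the set `EETL`. -/
def phiEETL : MvPolynomial (EETL p lam S) k →ₐ[k] Sh lam S := aeval fun x => x.1

variable {S}

/-- The variable of a word in `TL₁`. -/
def var₁ (v : TL₁ p S) : MvPolynomial (EETL p lam S) k :=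
  X ⟨word lam v.1, Or.inl ⟨v.1, v.2, rfl⟩⟩

/-- The variable of an element of `EETL₂`. -/
def var₂ (x : EETL₂ p lam S) : MvPolynomial (EETL p lam S) k := X ⟨x.1, Or.inr x.2⟩

/-- The polynomial `v ^ p - lam ^ ((ℓ(v) - 1) (p - 1)) v`, for `v` in `TL₁`. -/
def rel₁ (v : TL₁ p S) : MvPolynomial (EETL p lam S) k :=
  var₁ p lam v ^ p - C (lam ^ ((v.1.length - 1) * (p - 1))) * var₁ p lam v

/-- The polynomial `x ^ p`, for `x` in `EETL₂`. -/
def rel₂ (x : EETL₂ p lam S) : MvPolynomial (EETL p lam S) k := var₂ p lam x ^ p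

variable {p lam}

/-- `Q₁`, `Q₂` are polynomials with `φ (rel₁ v) = p φ (Q₁ v)` and `φ (rel₂ x) = p φ (Q₂ x)`. -/
def IsLift (Q₁ : TL₁ p S → MvPolynomial (EETL p lam S) k)
    (Q₂ : EETL₂ p lam S → MvPolynomial (EETL p lam S) k) : Prop :=
  (∀ v, phiEETL p lam S (rel₁ p lam v) = (p : Sh lam S) * phiEETL p lam S (Q₁ v)) ∧
  (∀ x, phiEETL p lam S (rel₂ p lam x) = (p : Sh lam S) * phiEETL p lam S (Q₂ x))

/-- The ideal generated by the lifted relations `rel₁ v - p Q₁ v` and `rel₂ x - p Q₂ x`. -/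
def relIdeal (Q₁ : TL₁ p S → MvPolynomial (EETL p lam S) k)
    (Q₂ : EETL₂ p lam S → MvPolynomial (EETL p lam S) k) :
    Ideal (MvPolynomial (EETL p lam S) k) :=
  Ideal.span (Set.range (fun v => rel₁ p lam v - (p : MvPolynomial (EETL p lam S) k) * Q₁ v) ∪
    Set.range (fun x => rel₂ p lam x - (p : MvPolynomial (EETL p lam S) k) * Q₂ x))

end ClassJ

/-- The closure of an ideal `I` in the `p`-adic topology, `⋂ₙ (I + pⁿ R)`. -/
def padicClosure {R : Type*} [CommRing R] (p : ℕ) (I : Ideal R) : Ideal R :=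
  ⨅ n : ℕ, I ⊔ Ideal.span {(p : R) ^ n}

end MixShuffle

end

/-!
Both parts of the theorem rest on one basis of `Sh(S)`, valid for every well-ordered semigroup `S`.

*The basis.* Order the words by length, then lexicographically. The terms of top length of the
product of two words are their shuffles, so the leading word of a product is the largest shuffle
`maxMerge u v` of the leading words `u`, `v`, and `maxMerge` is strictly increasing in both
arguments. It is computed greedily: always take the next letter from the larger remaining word
(`maxMerge_cons_of_le`). For a Lyndon word `l` and a word `v < l` this gives `l ^ n v` as the
largest shuffle of `l ^ n` and `v`, with multiplicity one, and `l ^ (a + b)` as the largest shuffle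
of `l ^ a` and `l ^ b`, with multiplicity `(a + b).choose a`
(`shufCount_tensorPow_of_lt`, `shufCount_tensorPow_tensorPow`). Every word is uniquely a product of
powers of Lyndon words in decreasing order; writing the exponents in base `p` avoids carries, so the
binomial coefficients that occur are prime to `p`. Hence, if `y (l, j)` has leading word
`l ^ (p ^ j)`, the monomials in the `y (l, j)` with exponents less than `p` have all words as
leading words, once each and with unit coefficients, and form a basis (`bijective_restrictDegree`).

*Frobenius.* Modulo `p`, the `p`-th power of a word `w` is `w^(p)` (`dvd_word_pow_sub`), because
`(a ⊗ x) ^ n` is a sum with binomial coefficients of terms `a ^ j ⊗ (...)` (`consLin_pow`) and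
`lam ^ (p - 1) ≡ 1`.

*Semigroups with `g ^ (p ^ 2) = g ^ p`.* Letters with `g ^ p = g` are the smaller ones, so
`w - w^(p)` has leading word `w` if `w^(p) ≠ w`, and the basis applies to the elements of `EETL`.
Modulo `p` the relations hold by Frobenius; conversely they reduce each polynomial, modulo `I` and
any power of `p`, to exponents less than `p`, where the map is bijective. So the kernel is the
`p`-adic closure of `I` (`mem_padicClosure_of_map_eq_zero`).

*The free abelian semigroup.* Here raising letters to the `p`-th power is injective and preserves
and reflects the Lyndon property, so each Lyndon word is uniquely `e^(p^j)` with `e` in `E(Lyn)`.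
Modulo `p`, the truncated monomials in the words `l ^ (p ^ i)`, `l` Lyndon, are therefore all
monomials in the elements of `TEL` (base `p` again). Thus the map from `ℤ_[p][TEL]` is bijective
modulo `p`; it is injective since both sides are torsion-free and the source is `p`-adically
separated, and surjective by Nakayama's lemma in each degree. The statements on indecomposable
elements and on cardinalities follow.
-/

noncomputable section

namespace MixShuffle

open MvPolynomial

/-! ### Shuffles of words and the lexicographically largest shuffle -/

section Shuffles

variable {S : Type*} [LinearOrder S]

/-- The number of ways in which the word `z` is a shuffle of the words `u` and `v`. -/
def shufCount : List S → List S → List S → ℕ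
  | u, v, [] => if u = [] ∧ v = [] then 1 else 0
  | u, v, e :: z =>
    (match u with
      | [] => 0
      | a :: u' => if a = e then shufCount u' v z else 0) +
    (match v with
      | [] => 0
      | b :: v' => if b = e then shufCount u v' z else 0)

theorem shufCount_nil (u v : List S) :
    shufCount u v [] = if u = [] ∧ v = [] then 1 else 0 := by
  rw [shufCount]

theorem shufCount_eq_add (u v : List S) (e : S) (z : List S) :
    shufCount u v (e :: z) =
      (match u with
        | [] => 0
        | a :: u' => if a = e then shufCount u' v z else 0) +
      (match v with
        | [] => 0
        | b :: v' => if b = e then shufCount u v' z else 0) := by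
  rw [shufCount.eq_def]

theorem shufCount_cons (a b e : S) (u v z : List S) :
    shufCount (a :: u) (b :: v) (e :: z) =
      (if a = e then shufCount u (b :: v) z else 0) +
        (if b = e then shufCount (a :: u) v z else 0) := by
  rw [shufCount]

theorem shufCount_nil_cons (e : S) (v z : List S) :
    shufCount [] v (e :: z) =
      (match v with
      | [] => 0
      | b :: v' => if b = e then shufCount [] v' z else 0) := by
  rw [shufCount_eq_add, zero_add]

theorem shufCount_comm (u v z : List S) : shufCount u v z = shufCount v u z := by
  induction z generalizing u v with
  | nil => simp only [shufCount_nil, and_comm]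
  | cons e z ih =>
    rw [shufCount_eq_add, shufCount_eq_add, add_comm]
    congr 1
    · cases v <;> simp only [ih]
    · cases u <;> simp only [ih]

theorem shufCount_nil_left (v z : List S) : shufCount [] v z = if v = z then 1 else 0 := by
  induction z generalizing v with
  | nil => simp [shufCount_nil]
  | cons e z ih =>
    rw [shufCount_nil_cons]
    cases v with
    | nil => simp
    | cons b v =>
      simp only [ih, List.cons.injEq]
      split_ifs <;> simp_all

theorem shufCount_nil_right (u z : List S) : shufCount u [] z = if u = z then 1 else 0 := by
  rw [shufCount_comm, shufCount_nil_left]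

theorem length_of_shufCount_ne_zero {u v z : List S} (h : shufCount u v z ≠ 0) :
    z.length = u.length + v.length := by
  induction z generalizing u v with
  | nil =>
    rw [shufCount_nil] at h
    split_ifs at h with h'
    · simp [h'.1, h'.2]
    · simp at h
  | cons e z ih =>
    match u, v with
    | [], v => rw [shufCount_nil_left] at h; simp at h; simp [h]
    | a :: u, [] => rw [shufCount_nil_right] at h; simp at h; simp [h]
    | a :: u, b :: v =>
      rw [shufCount_cons] at h
      have h' : (if a = e then shufCount u (b :: v) z else 0) ≠ 0 ∨
        (if b = e then shufCount (a :: u) v z else 0) ≠ 0 := by omega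
      rcases h' with h' | h'
      · split_ifs at h' with h2
        · have := ih h'
          simp only [List.length_cons] at *; omega
        · simp at h'
      · split_ifs at h' with h2
        · have := ih h'
          simp only [List.length_cons] at *; omega
        · simp at h'

/-- A shuffle of `u` and `v` with a prescribed prefix `x` consists of a shuffle of a prefix of `u`
and a prefix of `v`, followed by a shuffle of what is left. The terms in which the prefixes are too
short vanish. -/
theorem shufCount_append (u v x y : List S) :
    shufCount u v (x ++ y) = ∑ i ∈ Finset.range (x.length + 1),
      shufCount (u.take i) (v.take (x.length - i)) x *
        shufCount (u.drop i) (v.drop (x.length - i)) y := by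
  induction x generalizing u v with
  | nil => simp [shufCount_nil]
  | cons e x ih =>
    have hL : ∀ i ∈ Finset.range (x.length + 1),
        (x.length + 1 - i) = (x.length - i) + 1 := by
      intro i hi
      rw [Finset.mem_range] at hi
      omega
    rw [List.cons_append, shufCount_eq_add]
    simp only [List.length_cons]
    simp only [shufCount_eq_add _ _ e, add_mul, Finset.sum_add_distrib]
    congr 1
    · rw [Finset.sum_range_succ']
      cases u with
      | nil => simp
      | cons a u =>
        simp only [List.take_succ_cons, List.drop_succ_cons, List.take_zero, zero_mul, add_zero]
        split_ifs with h
        · rw [ih]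
          simp
        · simp
    · rw [Finset.sum_range_succ]
      cases v with
      | nil => simp
      | cons b v =>
        simp only [Nat.sub_self, List.take_zero, zero_mul, add_zero]
        split_ifs with h
        · rw [ih]
          refine Finset.sum_congr rfl fun i hi => ?_
          rw [hL i hi]
          simp [h]
        · symm
          refine Finset.sum_eq_zero fun i hi => ?_
          rw [hL i hi]
          simp [h]

theorem shufCount_append_ne_zero {α β γ δ x y : List S} (h1 : shufCount α γ x ≠ 0)
    (h2 : shufCount β δ y ≠ 0) : shufCount (α ++ β) (γ ++ δ) (x ++ y) ≠ 0 := by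
  have hx := length_of_shufCount_ne_zero h1
  rw [shufCount_append]
  intro h
  rw [Finset.sum_eq_zero_iff] at h
  have := h α.length (by simp; omega)
  rw [show x.length - α.length = γ.length by omega] at this
  simp at this
  tauto

/-- The lexicographically largest shuffle of two words. -/
def maxMerge : List S → List S → List S
  | [], v => v
  | a :: u, [] => a :: u
  | a :: u, b :: v => max (a :: maxMerge u (b :: v)) (b :: maxMerge (a :: u) v)
termination_by u v => u.length + v.length

theorem maxMerge_nil_left (v : List S) : maxMerge [] v = v := by rw [maxMerge]

theorem maxMerge_nil_right (u : List S) : maxMerge u [] = u := by cases u <;> rw [maxMerge]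

theorem maxMerge_comm (u v : List S) : maxMerge u v = maxMerge v u := by
  match u, v with
  | [], v => rw [maxMerge_nil_right, maxMerge]
  | a :: u, [] => rw [maxMerge_nil_right, maxMerge]
  | a :: u, b :: v =>
    rw [maxMerge, maxMerge, max_comm, maxMerge_comm u, maxMerge_comm (a :: u)]
termination_by u.length + v.length

theorem length_maxMerge (u v : List S) : (maxMerge u v).length = u.length + v.length := by
  match u, v with
  | [], v => simp [maxMerge]
  | a :: u, [] => simp [maxMerge]
  | a :: u, b :: v =>
    have h1 := length_maxMerge u (b :: v)
    have h2 := length_maxMerge (a :: u) v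
    rw [maxMerge]
    rcases max_choice (a :: maxMerge u (b :: v)) (b :: maxMerge (a :: u) v) with h | h <;>
      rw [h] <;> simp only [List.length_cons] at * <;> omega
termination_by u.length + v.length

theorem cons_lt_cons_of_lt (a : S) {u v : List S} (h : u < v) : a :: u < a :: v :=
  List.cons_lt_cons_iff.2 (Or.inr ⟨rfl, h⟩)

theorem cons_le_cons_of_le (a : S) {u v : List S} (h : u ≤ v) : a :: u ≤ a :: v := by
  rcases h.eq_or_lt with rfl | h
  · exact le_rfl
  · exact (cons_lt_cons_of_lt a h).le

theorem append_le_append_of_le (x : List S) {u v : List S} (h : u ≤ v) : x ++ u ≤ x ++ v := by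
  induction x with
  | nil => exact h
  | cons a x ih => exact cons_le_cons_of_le a ih

theorem cons_maxMerge_le_left (a : S) (u v : List S) :
    a :: maxMerge u v ≤ maxMerge (a :: u) v := by
  cases v with
  | nil => rw [maxMerge_nil_right, maxMerge_nil_right]
  | cons b v => rw [maxMerge.eq_3]; exact le_max_left _ _

theorem cons_maxMerge_le_right (a : S) (u v : List S) :
    a :: maxMerge u v ≤ maxMerge u (a :: v) := by
  rw [maxMerge_comm u, maxMerge_comm u]
  exact cons_maxMerge_le_left a v u

theorem append_le_maxMerge (u v : List S) : u ++ v ≤ maxMerge u v := by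
  induction u with
  | nil => rw [maxMerge]; rfl
  | cons a u ih => exact (cons_le_cons_of_le a ih).trans (cons_maxMerge_le_left a u v)

theorem le_maxMerge_of_shufCount_ne_zero {u v z : List S} (h : shufCount u v z ≠ 0) :
    z ≤ maxMerge u v := by
  induction z generalizing u v with
  | nil =>
    rw [shufCount_nil] at h
    split_ifs at h with h'
    · simp [h'.1, h'.2, maxMerge]
    · simp at h
  | cons e z ih =>
    match u, v with
    | [], v => rw [shufCount_nil_left] at h; simp at h; simp [h, maxMerge]
    | a :: u, [] => rw [shufCount_nil_right] at h; simp at h; simp [h, maxMerge]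
    | a :: u, b :: v =>
      rw [shufCount_cons] at h
      have h' : (if a = e then shufCount u (b :: v) z else 0) ≠ 0 ∨
        (if b = e then shufCount (a :: u) v z else 0) ≠ 0 := by omega
      rcases h' with h' | h'
      · split_ifs at h' with h2
        · subst h2
          exact (cons_le_cons_of_le a (ih h')).trans (cons_maxMerge_le_left _ _ _)
        · simp at h'
      · split_ifs at h' with h2
        · subst h2
          exact (cons_le_cons_of_le b (ih h')).trans (cons_maxMerge_le_right _ _ _)
        · simp at h'

theorem shufCount_maxMerge_ne_zero (u v : List S) : shufCount u v (maxMerge u v) ≠ 0 := by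
  match u, v with
  | [], v => simp [maxMerge, shufCount_nil_left]
  | a :: u, [] => simp [maxMerge, shufCount_nil_right]
  | a :: u, b :: v =>
    have h1 := shufCount_maxMerge_ne_zero u (b :: v)
    have h2 := shufCount_maxMerge_ne_zero (a :: u) v
    rw [maxMerge]
    rcases max_choice (a :: maxMerge u (b :: v)) (b :: maxMerge (a :: u) v) with h | h <;>
      rw [h, shufCount_cons, if_pos rfl] <;> omega
termination_by u.length + v.length

theorem maxMerge_lt_maxMerge_left {u u' : List S} (v : List S) (hl : u'.length = u.length)
    (h : u' < u) : maxMerge u' v < maxMerge u v := by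
  match u', u, v with
  | [], [], v => exact absurd h (lt_irrefl _)
  | a' :: u', a :: u, [] => simpa [maxMerge_nil_right] using h
  | a' :: u', a :: u, b :: v =>
    rw [maxMerge.eq_3 a' u']
    apply max_lt
    · refine lt_of_lt_of_le ?_ (cons_maxMerge_le_left _ _ _)
      rcases List.cons_lt_cons_iff.1 h with h' | ⟨rfl, h'⟩
      · exact List.cons_lt_cons_iff.2 (Or.inl h')
      · exact cons_lt_cons_of_lt _ (maxMerge_lt_maxMerge_left (b :: v) (by simpa using hl) h')
    · exact lt_of_lt_of_le (cons_lt_cons_of_lt _ (maxMerge_lt_maxMerge_left v hl h))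
        (cons_maxMerge_le_right _ _ _)
termination_by u.length + v.length

/-- The greedy description of the largest shuffle (first component), proved simultaneously with the
fact that the largest shuffle does not decrease when a prefix moves from the larger word to the
smaller one (second component). -/
theorem maxMerge_greedy_aux (n : ℕ) :
    (∀ (a : S) (u v : List S), u.length + 1 + v.length ≤ n → v ≤ a :: u →
      maxMerge (a :: u) v = a :: maxMerge u v) ∧
    (∀ x u v : List S, x.length + u.length + v.length ≤ n → v ≤ u →
      maxMerge (x ++ u) v ≤ maxMerge u (x ++ v)) := by
  induction n with
  | zero =>
    refine ⟨fun a u v h => by omega, fun x u v h _ => ?_⟩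
    have hx : x = [] := List.length_eq_zero_iff.1 (by omega)
    simp [hx]
  | succ n ih =>
    have h1 : ∀ (a : S) (u v : List S), u.length + 1 + v.length ≤ n + 1 → v ≤ a :: u →
        maxMerge (a :: u) v = a :: maxMerge u v := by
      intro a u v hn hv
      cases v with
      | nil => rw [maxMerge_nil_right, maxMerge_nil_right]
      | cons b v =>
        rw [maxMerge, max_eq_left]
        rcases hv.eq_or_lt with hv | hv
        · obtain ⟨rfl, rfl⟩ := List.cons_eq_cons.1 hv
          exact cons_le_cons_of_le _ (ih.2 [b] v v (by simp at *; omega) le_rfl)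
        · rcases List.cons_lt_cons_iff.1 hv with h | ⟨rfl, h⟩
          · exact (List.cons_lt_cons_iff.2 (Or.inl h)).le
          · exact cons_le_cons_of_le _ (ih.2 [b] u v (by simp at *; omega) h.le)
    refine ⟨h1, fun x u v hn hv => ?_⟩
    cases x with
    | nil => simp
    | cons e x =>
      simp only [List.cons_append, List.length_cons] at *
      rcases le_or_gt v (e :: (x ++ u)) with h | h
      · rw [h1 e (x ++ u) v (by simp; omega) h]
        exact (cons_le_cons_of_le e (ih.2 x u v (by omega) hv)).trans
          (cons_maxMerge_le_right _ _ _)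
      · match u, v with
        | _, [] => exact absurd h (by simp)
        | [], c :: v => exact absurd hv (by simp)
        | d :: u, c :: v =>
          rw [maxMerge_comm, h1 c v _ (by simp at *; omega) h.le, maxMerge_comm v]
          refine le_trans ?_ (cons_maxMerge_le_left _ _ _)
          -- If `u` and `v` start with the same letter, it joins the prefix `e :: x`.
          rcases hv.eq_or_lt with hv | hv
          · obtain ⟨rfl, rfl⟩ := List.cons_eq_cons.1 hv
            have := ih.2 (e :: (x ++ [c])) v v (by simp at *; omega) le_rfl
            simp only [List.append_assoc, List.cons_append, List.nil_append] at this
            exact cons_le_cons_of_le _ this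
          · rcases List.cons_lt_cons_iff.1 hv with h' | ⟨rfl, h'⟩
            · exact (List.cons_lt_cons_iff.2 (Or.inl h')).le
            · have := ih.2 (e :: (x ++ [c])) u v (by simp at *; omega) h'.le
              simp only [List.append_assoc, List.cons_append, List.nil_append] at this
              exact cons_le_cons_of_le _ this

/-- The largest shuffle starts with the first letter of the larger word. -/
theorem maxMerge_cons_of_le {a : S} {u v : List S} (h : v ≤ a :: u) :
    maxMerge (a :: u) v = a :: maxMerge u v :=
  (maxMerge_greedy_aux _).1 a u v le_rfl h

/-- If every nonempty suffix `t` of `s` satisfies `v ≤ t ++ u`, then `s` is used up first. -/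
theorem maxMerge_append_of_le {s u v : List S} (h : ∀ t, t ≠ [] → t <:+ s → v ≤ t ++ u) :
    maxMerge (s ++ u) v = s ++ maxMerge u v := by
  induction s with
  | nil => rfl
  | cons a s ih =>
    have h0 : v ≤ a :: (s ++ u) := h (a :: s) (by simp) List.suffix_rfl
    rw [List.cons_append, maxMerge_cons_of_le h0,
      ih fun t ht hs => h t ht (hs.trans (List.suffix_cons a s)), List.cons_append]

/-- If `u = α ++ β`, `v = γ ++ δ`, and `x` is a shuffle of `α` and `γ`, then `x ++ β ++ δ` is a
shuffle of `u` and `v`. -/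
theorem append_le_maxMerge_of_shufCount {α β γ δ x : List S} (h : shufCount α γ x ≠ 0) :
    x ++ (β ++ δ) ≤ maxMerge (α ++ β) (γ ++ δ) := by
  refine le_trans ?_ (le_maxMerge_of_shufCount_ne_zero
    (shufCount_append_ne_zero h (shufCount_maxMerge_ne_zero β δ)))
  exact append_le_append_of_le x (append_le_maxMerge β δ)

end Shuffles

/-! ### Lyndon words -/

section Powers

variable {S : Type*}

theorem tensorPow_zero (w : List S) : tensorPow w 0 = [] := rfl

theorem tensorPow_succ (w : List S) (n : ℕ) : tensorPow w (n + 1) = w ++ tensorPow w n := by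
  simp [tensorPow, List.replicate_succ]

theorem tensorPow_one (w : List S) : tensorPow w 1 = w := by
  simp [tensorPow_succ, tensorPow_zero]

theorem tensorPow_add (w : List S) (m n : ℕ) :
    tensorPow w (m + n) = tensorPow w m ++ tensorPow w n := by
  rw [tensorPow, List.replicate_add, List.flatten_append, tensorPow, tensorPow]

theorem exists_of_suffix_append {t u v : List S} (h : t <:+ u ++ v) :
    t <:+ v ∨ ∃ s, s ≠ [] ∧ s <:+ u ∧ t = s ++ v := by
  obtain ⟨q, hq⟩ := h
  rcases List.append_eq_append_iff.1 hq with ⟨c, h1, h2⟩ | ⟨c, h1, h2⟩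
  · by_cases hc : c = []
    · subst hc
      exact Or.inl ⟨[], by simpa using h2⟩
    · exact Or.inr ⟨c, hc, ⟨q, h1.symm⟩, h2⟩
  · exact Or.inl ⟨c, h2.symm⟩

theorem exists_of_suffix_tensorPow {t l : List S} {n : ℕ} (ht : t ≠ [])
    (h : t <:+ tensorPow l n) :
    ∃ s j, s ≠ [] ∧ s <:+ l ∧ t = s ++ tensorPow l j := by
  induction n with
  | zero => exact absurd (List.suffix_nil.1 h) ht
  | succ n ih =>
    rw [tensorPow_succ] at h
    rcases exists_of_suffix_append h with h | ⟨s, h1, h2, h3⟩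
    · exact ih h
    · exact ⟨s, n, h1, h2, h3⟩

end Powers

section Lyndon

variable {S : Type*} [LinearOrder S]

theorem nil_le (u : List S) : [] ≤ u := not_lt.1 (List.not_lt_nil u)

theorem le_append_right (u x : List S) : u ≤ u ++ x := by
  have := append_le_append_of_le u (nil_le x)
  simpa using this

theorem append_lt_append_of_lt (x : List S) {u v : List S} (h : u < v) : x ++ u < x ++ v := by
  induction x with
  | nil => exact h
  | cons a x ih => exact cons_lt_cons_of_lt a ih

theorem append_lt_append_left_iff (x : List S) {u v : List S} : x ++ u < x ++ v ↔ u < v := by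
  refine ⟨fun h => lt_of_not_ge fun h' => ?_, append_lt_append_of_lt x⟩
  exact absurd (append_le_append_of_le x h') (not_le.2 h)

theorem append_le_append_left_iff (x : List S) {u v : List S} : x ++ u ≤ x ++ v ↔ u ≤ v := by
  rw [← not_lt, ← not_lt, append_lt_append_left_iff]

theorem append_lt_append_of_not_prefix {u v : List S} (h : u < v) (hp : ¬ u <+: v)
    (x y : List S) : u ++ x < v ++ y := by
  induction u generalizing v with
  | nil => exact absurd List.nil_prefix hp
  | cons a u ih =>
    cases v with
    | nil => simp at h
    | cons b v =>
      simp only [List.cons_append]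
      rcases List.cons_lt_cons_iff.1 h with h' | ⟨rfl, h'⟩
      · exact List.cons_lt_cons_iff.2 (Or.inl h')
      · refine cons_lt_cons_of_lt a (ih h' fun hp' => hp ?_)
        exact List.cons_prefix_cons.2 ⟨rfl, hp'⟩

/-- A strict inequality in which the larger word is not longer is decided by a letter, and
persists after appending words on both sides. -/
theorem append_lt_append_of_length_le {u v : List S} (h : u < v) (hl : v.length ≤ u.length)
    (x y : List S) : u ++ x < v ++ y := by
  refine append_lt_append_of_not_prefix h (fun hp => ?_) x y
  exact h.ne (hp.eq_of_length (le_antisymm hp.length_le hl))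

theorem nil_lt_of_mem_Lyn {l : List S} (hl : l ∈ Lyn S) : [] < l := by
  cases l with
  | nil => exact absurd rfl hl.1
  | cons a l => exact List.nil_lt_cons a l

theorem lt_append_of_ne_nil (u : List S) {x : List S} (hx : x ≠ []) : u < u ++ x := by
  refine lt_of_le_of_ne (le_append_right u x) fun h => hx ?_
  simpa using h

theorem lt_of_mem_Lyn_of_append {u s : List S} (hl : u ++ s ∈ Lyn S) (hu : u ≠ []) (hs : s ≠ []) :
    u ++ s < s := hl.2 u s hu hs rfl

theorem lt_of_mem_Lyn_of_suffix {l s : List S} (hl : l ∈ Lyn S) (hs : s ≠ []) (h : s <:+ l)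
    (hne : s ≠ l) : l < s ∧ s.length < l.length := by
  obtain ⟨u, rfl⟩ := h
  have hu : u ≠ [] := by rintro rfl; exact hne rfl
  refine ⟨lt_of_mem_Lyn_of_append hl hu hs, ?_⟩
  have := List.length_pos_iff.2 hu
  simp; omega

theorem le_of_mem_Lyn_of_suffix {l s : List S} (hl : l ∈ Lyn S) (hs : s ≠ []) (h : s <:+ l) :
    l ≤ s := by
  by_cases hne : s = l
  · exact hne.ge
  · exact (lt_of_mem_Lyn_of_suffix hl hs h hne).1.le

theorem le_of_suffix_tensorPow {l t : List S} {n : ℕ} (hl : l ∈ Lyn S) (ht : t ≠ [])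
    (h : t <:+ tensorPow l n) : l ≤ t := by
  obtain ⟨s, j, hs, hsl, rfl⟩ := exists_of_suffix_tensorPow ht h
  exact (le_of_mem_Lyn_of_suffix hl hs hsl).trans (le_append_right _ _)

/-- For `l` Lyndon and `v < l`, the largest shuffle of a power of `l` and `v` is their
concatenation. -/
theorem maxMerge_tensorPow_of_lt {l v : List S} (hl : l ∈ Lyn S) (hv : v < l) (n : ℕ) :
    maxMerge (tensorPow l n) v = tensorPow l n ++ v := by
  have := maxMerge_append_of_le (s := tensorPow l n) (u := []) (v := v) fun t ht h => by
    rw [List.append_nil]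
    exact hv.le.trans (le_of_suffix_tensorPow hl ht h)
  rwa [List.append_nil, maxMerge_nil_left] at this

/-- For `l` Lyndon and `v < l`, the concatenation of a power of `l` and `v` arises as a shuffle
in one way only: in any other way, a nonempty suffix of the power of `l` would be shuffled into the
final `v`, and being larger than `v` it could be used to build a shuffle larger than the largest
one. -/
theorem shufCount_tensorPow_of_lt {l v : List S} (hl : l ∈ Lyn S) (hv : v < l) (n : ℕ) :
    shufCount (tensorPow l n) v (tensorPow l n ++ v) = 1 := by
  rw [shufCount_append, Finset.sum_eq_single (tensorPow l n).length]
  · simp [shufCount_nil_left, shufCount_nil_right]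
  · -- A nonempty suffix of the power of `l` goes into the part after the first `|l ^ n|` letters.
    intro i hi hne
    rw [Finset.mem_range] at hi
    by_contra h
    have h1 := left_ne_zero_of_mul h
    have h3 := append_le_maxMerge_of_shufCount (β := (tensorPow l n).drop i)
      (δ := v.drop ((tensorPow l n).length - i)) h1
    rw [List.take_append_drop, List.take_append_drop, maxMerge_tensorPow_of_lt hl hv,
      append_le_append_left_iff] at h3
    have h4 : l ≤ (tensorPow l n).drop i := by
      refine le_of_suffix_tensorPow hl ?_ (List.drop_suffix i _)
      intro h
      rw [List.drop_eq_nil_iff] at h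
      omega
    exact absurd ((h4.trans (le_append_right _ _)).trans h3) (not_le.2 hv)
  · simp

theorem maxMerge_tensorPow_tensorPow {l : List S} (hl : l ∈ Lyn S) (a b : ℕ) :
    maxMerge (tensorPow l a) (tensorPow l b) = tensorPow l (a + b) := by
  induction hn : a + b generalizing a b with
  | zero =>
    obtain ⟨rfl, rfl⟩ := Nat.add_eq_zero_iff.1 hn
    simp [tensorPow_zero, maxMerge]
  | succ n ih =>
    wlog hab : b ≤ a generalizing a b
    · rw [maxMerge_comm]
      exact this b a (by omega) (by omega)
    obtain ⟨a, rfl⟩ : ∃ a', a = a' + 1 := ⟨a - 1, by omega⟩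
    rw [tensorPow_succ, maxMerge_append_of_le, ih a b (by omega), tensorPow_succ]
    intro t ht hs
    by_cases hne : t = l
    · subst hne
      rw [← tensorPow_succ, show a + 1 = b + (a + 1 - b) by omega, tensorPow_add]
      exact le_append_right _ _
    · obtain ⟨h1, h2⟩ := lt_of_mem_Lyn_of_suffix hl ht hs hne
      cases b with
      | zero => exact nil_le _
      | succ b =>
        rw [tensorPow_succ]
        exact (append_lt_append_of_length_le h1 h2.le _ _).le

/-- Powers of a Lyndon word shuffle like divided powers. -/
theorem shufCount_tensorPow_tensorPow {l : List S} (hl : l ∈ Lyn S) (a b : ℕ) :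
    shufCount (tensorPow l a) (tensorPow l b) (tensorPow l (a + b)) = (a + b).choose a := by
  induction hn : a + b generalizing a b with
  | zero =>
    obtain ⟨rfl, rfl⟩ := Nat.add_eq_zero_iff.1 hn
    simp [tensorPow_zero, shufCount_nil]
  | succ n ih =>
    match a, b with
    | 0, b => rw [← hn]; simp [tensorPow_zero, shufCount_nil_left]
    | a, 0 => rw [← hn]; simp [tensorPow_zero, shufCount_nil_right]
    | a + 1, b + 1 =>
      have hl0 := List.length_pos_iff.2 hl.1
      -- The first `|l|` letters come from one factor, and Pascal's rule applies.
      rw [tensorPow_succ l n, shufCount_append,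
        Finset.sum_eq_add 0 l.length (by omega)]
      · have h1 := ih a (b + 1) (by omega)
        have h2 := ih (a + 1) b (by omega)
        rw [tensorPow_succ] at h1 h2
        rw [Nat.choose_succ_succ, ← h1, show a + 1 = a.succ from rfl, ← h2]
        simp [tensorPow_succ, shufCount_nil_left, shufCount_nil_right, add_comm]
      · -- Otherwise a proper suffix of `l` goes into the rest, and yields a larger shuffle.
        intro i hi hne
        rw [Finset.mem_range] at hi
        by_contra h
        have h3 := append_le_maxMerge_of_shufCount (β := (tensorPow l (a + 1)).drop i)
          (δ := (tensorPow l (b + 1)).drop (l.length - i)) (left_ne_zero_of_mul h)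
        rw [List.take_append_drop, List.take_append_drop, maxMerge_tensorPow_tensorPow hl,
          hn, tensorPow_succ l n, append_le_append_left_iff, tensorPow_succ l a,
          List.drop_append_of_le_length (by omega), List.append_assoc,
          show n = (n - 1) + 1 by omega, tensorPow_succ l (n - 1)] at h3
        have hs : l < l.drop i ∧ (l.drop i).length < l.length := by
          refine lt_of_mem_Lyn_of_suffix hl (fun h => ?_) (List.drop_suffix i l) fun h => ?_
          · rw [List.drop_eq_nil_iff] at h
            omega
          · have := congrArg List.length h
            rw [List.length_drop] at this
            omega
        exact absurd h3 (not_le.2 (append_lt_append_of_length_le hs.1 hs.2.le _ _))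
      · simp
      · simp

theorem singleton_mem_Lyn (a : S) : [a] ∈ Lyn S := by
  refine ⟨by simp, fun u v hu hv h => ?_⟩
  have := congrArg List.length h
  have h1 := List.length_pos_iff.2 hu
  have h2 := List.length_pos_iff.2 hv
  simp at this
  omega

theorem append_mem_Lyn {l m : List S} (hl : l ∈ Lyn S) (hm : m ∈ Lyn S) (h : l < m) :
    l ++ m ∈ Lyn S := by
  have hlm : l ++ m < m := by
    by_cases hp : l <+: m
    · obtain ⟨t, rfl⟩ := hp
      refine append_lt_append_of_lt l (lt_of_mem_Lyn_of_append hm hl.1 ?_)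
      rintro rfl
      simp at h
    · simpa using append_lt_append_of_not_prefix h hp m []
  refine ⟨by simp [hl.1], fun u v hu hv huv => ?_⟩
  change l ++ m < v
  have hs : v <:+ l ++ m := ⟨u, huv.symm⟩
  rcases exists_of_suffix_append hs with hs | ⟨s, h1, h2, rfl⟩
  · exact hlm.trans_le (le_of_mem_Lyn_of_suffix hm hv hs)
  · have hne : s ≠ l := by
      rintro rfl
      exact hu (by simpa using huv)
    obtain ⟨h3, h4⟩ := lt_of_mem_Lyn_of_suffix hl h1 h2 hne
    exact append_lt_append_of_length_le h3 h4.le _ _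

theorem append_lt_of_mem_Lyn {l m x : List S} (hl : l ∈ Lyn S) (hm : m ≠ []) (h : m < l)
    (hx : x < l) : m ++ x < l := by
  by_cases hp : m <+: l
  · obtain ⟨t, rfl⟩ := hp
    refine append_lt_append_of_lt m (hx.trans (lt_of_mem_Lyn_of_append hl hm ?_))
    rintro rfl
    simp at h
  · simpa using append_lt_append_of_not_prefix h hp x []

theorem tensorPow_append_lt {l m x : List S} (hl : l ∈ Lyn S) (hm : m ≠ []) (h : m < l)
    (hx : x < l) (n : ℕ) : tensorPow m n ++ x < l := by
  induction n with
  | zero => exact hx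
  | succ n ih =>
    rw [tensorPow_succ, List.append_assoc]
    exact append_lt_of_mem_Lyn hl hm h ih

/-- Merging `l` with the first Lyndon factor of `r`, as long as the latter is larger than `l`. -/
theorem exists_append_eq_tensorPow_append (n : ℕ) {l r : List S} (hl : l ∈ Lyn S)
    (hr : r.length ≤ n) :
    ∃ m ∈ Lyn S, ∃ k v, v < m ∧ l ++ r = tensorPow m (k + 1) ++ v := by
  induction n generalizing l r with
  | zero =>
    have : r = [] := List.length_eq_zero_iff.1 (by omega)
    exact ⟨l, hl, 0, [], nil_lt_of_mem_Lyn hl, by simp [this, tensorPow_one]⟩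
  | succ n ih =>
    cases r with
    | nil => exact ⟨l, hl, 0, [], nil_lt_of_mem_Lyn hl, by simp [tensorPow_one]⟩
    | cons b r =>
      obtain ⟨m, hm, k, v, hv, h⟩ := ih (singleton_mem_Lyn b) (r := r) (by simpa using hr)
      have hlen := congrArg List.length h
      have hm0 := List.length_pos_iff.2 hm.1
      simp only [List.singleton_append] at h
      rcases lt_trichotomy l m with hlm | rfl | hlm
      · obtain ⟨m', hm', k', v', hv', h'⟩ :=
          ih (append_mem_Lyn hl hm hlm) (r := tensorPow m k ++ v) (by
            rw [tensorPow_succ] at hlen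
            simp only [List.length_append, List.length_cons] at *
            simp at hlen
            omega)
        refine ⟨m', hm', k', v', hv', ?_⟩
        rw [← h', h, tensorPow_succ]
        simp
      · exact ⟨l, hl, k + 1, v, hv, by rw [h, tensorPow_succ _ (k + 1)]; simp⟩
      · refine ⟨l, hl, 0, b :: r, ?_, by rw [tensorPow_one]⟩
        rw [h]
        exact tensorPow_append_lt hl hm.1 hlm (hv.trans hlm) _

/-- Every nonempty word is a power of a Lyndon word `l` followed by a word smaller than `l`;
iterating this gives the factorization into a non-increasing sequence of Lyndon words. -/
theorem exists_eq_tensorPow_append {w : List S} (hw : w ≠ []) :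
    ∃ l ∈ Lyn S, ∃ k v, v < l ∧ w = tensorPow l (k + 1) ++ v := by
  cases w with
  | nil => exact absurd rfl hw
  | cons b r => exact exists_append_eq_tensorPow_append _ (singleton_mem_Lyn b) le_rfl

theorem exists_of_prefix_tensorPow_append {l m v : List S} {n : ℕ} (hv : v < l) (hm : m ≠ [])
    (h : m <+: tensorPow l n ++ v) : ∃ i q, q ≠ [] ∧ m = tensorPow l i ++ q ∧ q ≤ l := by
  induction n generalizing m with
  | zero =>
    obtain ⟨t, ht⟩ := h
    refine ⟨0, m, hm, rfl, (le_append_right m t).trans ?_⟩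
    rw [ht]
    exact hv.le
  | succ n ih =>
    obtain ⟨t, ht⟩ := h
    rw [tensorPow_succ, List.append_assoc] at ht
    rcases List.append_eq_append_iff.1 ht with ⟨c, h1, h2⟩ | ⟨c, h1, h2⟩
    · exact ⟨0, m, hm, rfl, h1 ▸ le_append_right m c⟩
    · by_cases hc : c = []
      · exact ⟨0, m, hm, rfl, by simp [h1, hc]⟩
      · obtain ⟨i, q, h3, h4, h5⟩ := ih hc ⟨t, h2.symm⟩
        exact ⟨i + 1, q, h3, by rw [h1, h4, tensorPow_succ, List.append_assoc], h5⟩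

/-- If `m` were longer, then `l < m`, and `m` would have a proper suffix that is at most `l`. -/
theorem length_le_of_tensorPow_append_eq {l m v y : List S} {k : ℕ} (hl : l ∈ Lyn S)
    (hm : m ∈ Lyn S) (hv : v < l) (h : tensorPow l (k + 1) ++ v = m ++ y) :
    m.length ≤ l.length := by
  by_contra hlt
  have hlm : l < m := by
    rw [tensorPow_succ, List.append_assoc] at h
    obtain ⟨c, rfl⟩ := List.prefix_of_prefix_length_le (l₁ := l) (l₂ := m) ⟨_, rfl⟩
      ⟨y, h.symm⟩ (by omega)
    refine lt_append_of_ne_nil l ?_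
    rintro rfl
    simp at hlt
  obtain ⟨i, q, hq, rfl, hql⟩ := exists_of_prefix_tensorPow_append hv hm.1 ⟨y, h.symm⟩
  cases i with
  | zero => exact absurd hql (not_le.2 hlm)
  | succ i =>
    have := lt_of_mem_Lyn_of_append hm (by rw [tensorPow_succ]; simp [hl.1]) hq
    exact absurd hql (not_le.2 (hlm.trans this))

theorem eq_of_tensorPow_append_eq {l v x : List S} {k j : ℕ} (hv : v < l) (hx : x < l)
    (h : tensorPow l k ++ v = tensorPow l j ++ x) : k = j ∧ v = x := by
  induction k generalizing j with
  | zero =>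
    cases j with
    | zero => exact ⟨rfl, h⟩
    | succ j =>
      rw [tensorPow_succ, tensorPow_zero, List.nil_append, List.append_assoc] at h
      exact absurd hv (not_lt.2 (h ▸ le_append_right _ _))
  | succ k ih =>
    cases j with
    | zero =>
      rw [tensorPow_succ, tensorPow_zero, List.nil_append, List.append_assoc] at h
      exact absurd hx (not_lt.2 (h ▸ le_append_right _ _))
    | succ j =>
      rw [tensorPow_succ, tensorPow_succ, List.append_assoc, List.append_assoc] at h
      obtain ⟨h1, h2⟩ := ih (List.append_cancel_left h)
      exact ⟨by omega, h2⟩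

/-- Uniqueness of the factorization `exists_eq_tensorPow_append`. -/
theorem tensorPow_append_injective {l m v x : List S} {k j : ℕ} (hl : l ∈ Lyn S)
    (hm : m ∈ Lyn S) (hv : v < l) (hx : x < m)
    (h : tensorPow l (k + 1) ++ v = tensorPow m (j + 1) ++ x) : l = m ∧ k = j ∧ v = x := by
  have h1 : l.length = m.length := by
    refine le_antisymm ?_ ?_
    · refine length_le_of_tensorPow_append_eq (k := j) hm hl hx (y := tensorPow l k ++ v) ?_
      rw [← h, tensorPow_succ, List.append_assoc]
    · refine length_le_of_tensorPow_append_eq (k := k) hl hm hv (y := tensorPow m j ++ x) ?_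
      rw [h, tensorPow_succ, List.append_assoc]
  have h2 : l = m := by
    rw [tensorPow_succ, tensorPow_succ, List.append_assoc, List.append_assoc] at h
    exact (List.append_inj h h1).1
  subst h2
  obtain ⟨h3, h4⟩ := eq_of_tensorPow_append_eq hv hx h
  exact ⟨rfl, by omega, h4⟩

theorem tensorPow_injective {l m : List S} {k j : ℕ} (hl : l ∈ Lyn S) (hm : m ∈ Lyn S)
    (hk : k ≠ 0) (hj : j ≠ 0) (h : tensorPow l k = tensorPow m j) : l = m ∧ k = j := by
  obtain ⟨k, rfl⟩ := Nat.exists_eq_succ_of_ne_zero hk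
  obtain ⟨j, rfl⟩ := Nat.exists_eq_succ_of_ne_zero hj
  obtain ⟨h1, h2, -⟩ := tensorPow_append_injective hl hm (nil_lt_of_mem_Lyn hl)
    (nil_lt_of_mem_Lyn hm) (by simpa using h)
  exact ⟨h1, by rw [h2]⟩

end Lyndon

/-! ### Leading words in the mixable shuffle algebra -/

section Leading

variable {k : Type*} [CommRing k] {lam : k} {S : Type*}

/-- The span of the words in a set `s`. -/
def wordSpan (lam : k) (s : Set (List S)) : Submodule k (Sh lam S) :=
  (Finsupp.supported k k s : Submodule k (List S →₀ k))

theorem wordSpan_eq_span (s : Set (List S)) :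
    wordSpan lam s = Submodule.span k (word lam '' s) :=
  Finsupp.supported_eq_span_single k s

theorem word_mem_wordSpan {s : Set (List S)} {w : List S} (h : w ∈ s) :
    word lam w ∈ wordSpan lam s := by
  rw [wordSpan_eq_span]
  exact Submodule.subset_span ⟨w, h, rfl⟩

theorem wordSpan_mono {s t : Set (List S)} (h : s ⊆ t) : wordSpan lam s ≤ wordSpan lam t :=
  Finsupp.supported_mono h

/-- The coefficient of a word. -/
def coeffWord (lam : k) (w : List S) : Sh lam S →ₗ[k] k :=
  (Finsupp.lapply w : (List S →₀ k) →ₗ[k] k)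

theorem coeffWord_word_self (w : List S) : coeffWord lam w (word lam w) = 1 :=
  Finsupp.single_eq_same

theorem coeffWord_word_of_ne {v w : List S} (h : v ≠ w) : coeffWord lam w (word lam v) = 0 :=
  Finsupp.single_eq_of_ne h.symm

theorem coeffWord_eq_zero_of_mem {s : Set (List S)} {x : Sh lam S} (hx : x ∈ wordSpan lam s)
    {w : List S} (hw : w ∉ s) : coeffWord lam w x = 0 :=
  (Finsupp.mem_supported' k x).1 hx w hw

theorem mem_wordSpan_iff {s : Set (List S)} {x : Sh lam S} :
    x ∈ wordSpan lam s ↔ ∀ w, w ∉ s → coeffWord lam w x = 0 :=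
  Finsupp.mem_supported' k x

theorem Sh_ext {x y : Sh lam S} (h : ∀ w, coeffWord lam w x = coeffWord lam w y) : x = y :=
  Finsupp.ext h

theorem span_word_eq_top : Submodule.span k (Set.range (word lam : List S → Sh lam S)) = ⊤ := by
  rw [← Set.image_univ, ← wordSpan_eq_span]
  exact Finsupp.supported_univ

theorem word_mul_word [CommSemigroup S] (u v : List S) :
    word lam u * word lam v = (mulWord lam u v : List S →₀ k) :=
  mulLin_single lam u v

theorem mul_mem_wordSpan_of_forall [CommSemigroup S] {s t : Set (List S)}
    {N : Submodule k (Sh lam S)}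
    (h : ∀ u ∈ s, ∀ v ∈ t, word lam u * word lam v ∈ N) {x y : Sh lam S}
    (hx : x ∈ wordSpan lam s) (hy : y ∈ wordSpan lam t) : x * y ∈ N := by
  rw [wordSpan_eq_span] at hx hy
  have : Submodule.span k (word lam '' s) * Submodule.span k (word lam '' t) ≤ N := by
    rw [Submodule.span_mul_span, Submodule.span_le]
    rintro _ ⟨_, ⟨u, hu, rfl⟩, _, ⟨v, hv, rfl⟩, rfl⟩
    exact h u hu v hv
  exact this (Submodule.mul_mem_mul hx hy)

theorem prepend_apply_cons [DecidableEq S] (a e : S) (f : List S →₀ k) (z : List S) :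
    prepend a f (e :: z) = if a = e then f z else 0 := by
  have hinj : Function.Injective (List.cons a) := List.cons_injective
  rw [prepend, Finsupp.lmapDomain_apply]
  split_ifs with h
  · subst h
    exact Finsupp.mapDomain_apply hinj f z
  · refine Finsupp.mapDomain_of_notMem_range f _ ?_
    rintro ⟨y, hy⟩
    exact h (List.cons_eq_cons.1 hy).1

variable [LinearOrder S]

/-- The part of top length of the mixable shuffle product is the shuffle product. -/
theorem mulWord_apply [CommSemigroup S] (u v z : List S) (h : u.length + v.length ≤ z.length) :
    mulWord lam u v z = shufCount u v z := by
  induction z generalizing u v with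
  | nil =>
    rw [List.length_nil] at h
    have hu : u = [] := List.length_eq_zero_iff.1 (by omega)
    have hv : v = [] := List.length_eq_zero_iff.1 (by omega)
    simp [hu, hv, mulWord, shufCount_nil]
  | cons e z ih =>
    match u, v with
    | [], v =>
      rw [mulWord, shufCount_nil_left, Finsupp.single_apply]
      simp
    | a :: u, [] =>
      rw [mulWord, shufCount_nil_right, Finsupp.single_apply]
      simp
    | a :: u, b :: v =>
      simp only [List.length_cons] at h
      have h0 : shufCount u v z = 0 := by
        by_contra h'
        have := length_of_shufCount_ne_zero h'
        omega
      rw [mulWord, Finsupp.add_apply, Finsupp.add_apply, Finsupp.smul_apply, prepend_apply_cons,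
        prepend_apply_cons, prepend_apply_cons, ih u (b :: v) (by simp; omega),
        ih (a :: u) v (by simp; omega), ih u v (by omega), h0, shufCount_cons]
      simp

/-- The length-lexicographic order on words. -/
def ShortLT (v w : List S) : Prop := List.Shortlex (· < ·) v w

theorem shortLT_iff {v w : List S} :
    ShortLT v w ↔ v.length < w.length ∨ v.length = w.length ∧ v < w := List.shortlex_def

theorem ShortLT.trans {u v w : List S} (h1 : ShortLT u v) (h2 : ShortLT v w) : ShortLT u w := by
  rw [shortLT_iff] at *
  rcases h1 with h1 | ⟨h1, h1'⟩ <;> rcases h2 with h2 | ⟨h2, h2'⟩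
  · exact Or.inl (h1.trans h2)
  · exact Or.inl (by omega)
  · exact Or.inl (by omega)
  · exact Or.inr ⟨by omega, h1'.trans h2'⟩

theorem ShortLT.irrefl (w : List S) : ¬ ShortLT w w := by
  rw [shortLT_iff]
  simp

theorem ShortLT.ne {v w : List S} (h : ShortLT v w) : v ≠ w := by
  rintro rfl
  exact ShortLT.irrefl v h

theorem ShortLT.trichotomy (v w : List S) : ShortLT v w ∨ v = w ∨ ShortLT w v := by
  rw [shortLT_iff, shortLT_iff]
  rcases lt_trichotomy v.length w.length with h | h | h
  · exact Or.inl (Or.inl h)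
  · rcases lt_trichotomy v w with h' | h' | h'
    · exact Or.inl (Or.inr ⟨h, h'⟩)
    · exact Or.inr (Or.inl h')
    · exact Or.inr (Or.inr (Or.inr ⟨h.symm, h'⟩))
  · exact Or.inr (Or.inr (Or.inl h))

theorem shortLT_maxMerge_left {u u' : List S} (v : List S) (h : ShortLT u' u) :
    ShortLT (maxMerge u' v) (maxMerge u v) := by
  rw [shortLT_iff] at *
  rw [length_maxMerge, length_maxMerge]
  rcases h with h | ⟨h, h'⟩
  · exact Or.inl (by omega)
  · exact Or.inr ⟨by omega, maxMerge_lt_maxMerge_left v h h'⟩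

theorem shortLT_maxMerge_right (u : List S) {v v' : List S} (h : ShortLT v' v) :
    ShortLT (maxMerge u v') (maxMerge u v) := by
  rw [maxMerge_comm u, maxMerge_comm u]
  exact shortLT_maxMerge_left u h

/-- The span of the words that are smaller than `w` in the length-lexicographic order. -/
def lowerSpan (lam : k) (w : List S) : Submodule k (Sh lam S) := wordSpan lam {v | ShortLT v w}

theorem lowerSpan_mono {v w : List S} (h : ShortLT v w) : lowerSpan lam v ≤ lowerSpan lam w :=
  wordSpan_mono fun _ hu => ShortLT.trans hu h

theorem word_mem_lowerSpan {v w : List S} (h : ShortLT v w) : word lam v ∈ lowerSpan lam w :=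
  word_mem_wordSpan h

/-- `x` is a unit multiple of the word `w` plus a combination of smaller words. -/
def HasUnitLead (x : Sh lam S) (w : List S) : Prop :=
  ∃ c : k, IsUnit c ∧ x - c • word lam w ∈ lowerSpan lam w

theorem hasUnitLead_word (w : List S) : HasUnitLead (word lam w) w :=
  ⟨1, isUnit_one, by simp⟩

theorem HasUnitLead.isUnit_coeff {x : Sh lam S} {w : List S} (h : HasUnitLead x w) :
    IsUnit (coeffWord lam w x) := by
  obtain ⟨c, hc, hx⟩ := h
  have := coeffWord_eq_zero_of_mem hx (w := w) (ShortLT.irrefl w)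
  rw [map_sub, map_smul, coeffWord_word_self, sub_eq_zero] at this
  rw [this]
  simpa using hc

theorem HasUnitLead.coeff_eq_zero {x : Sh lam S} {v w : List S} (h : HasUnitLead x v)
    (hv : ShortLT v w) : coeffWord lam w x = 0 := by
  obtain ⟨c, hc, hx⟩ := h
  have := coeffWord_eq_zero_of_mem hx (w := w) fun h' => ShortLT.irrefl w (ShortLT.trans h' hv)
  rw [map_sub, map_smul, coeffWord_word_of_ne hv.ne, sub_eq_zero] at this
  rw [this, smul_zero]

theorem HasUnitLead.unique [Nontrivial k] {x : Sh lam S} {v w : List S} (hv : HasUnitLead x v)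
    (hw : HasUnitLead x w) : v = w := by
  rcases ShortLT.trichotomy v w with h | h | h
  · exact absurd (hv.coeff_eq_zero h) hw.isUnit_coeff.ne_zero
  · exact h
  · exact absurd (hw.coeff_eq_zero h) hv.isUnit_coeff.ne_zero

variable [CommSemigroup S]

theorem word_mul_word_sub_mem (u v : List S) :
    word lam u * word lam v - (shufCount u v (maxMerge u v) : k) • word lam (maxMerge u v) ∈
      lowerSpan lam (maxMerge u v) := by
  refine mem_wordSpan_iff.2 fun w hw => ?_
  have hlen := length_maxMerge u v
  rw [Set.mem_ofPred_eq, shortLT_iff, not_or, not_and] at hw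
  have hc : coeffWord lam w (word lam u * word lam v) = shufCount u v w := by
    rw [word_mul_word]
    exact mulWord_apply u v w (by omega)
  rw [map_sub, map_smul, hc]
  by_cases h : w = maxMerge u v
  · rw [h, coeffWord_word_self]
    simp
  · rw [coeffWord_word_of_ne (Ne.symm h)]
    have : shufCount u v w = 0 := by
      by_contra h'
      have h1 := length_of_shufCount_ne_zero h'
      have h2 := le_maxMerge_of_shufCount_ne_zero h'
      exact hw.2 (by omega) (lt_of_le_of_ne h2 h)
    simp [this]

theorem word_mul_word_mem {u v w : List S} (h : ShortLT (maxMerge u v) w) :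
    word lam u * word lam v ∈ lowerSpan lam w := by
  have h1 := lowerSpan_mono h (word_mul_word_sub_mem (lam := lam) u v)
  have h2 := Submodule.smul_mem _ (shufCount u v (maxMerge u v) : k)
    (word_mem_lowerSpan (lam := lam) h)
  simpa using Submodule.add_mem _ h1 h2

/-- Leading words multiply by `maxMerge`, because `maxMerge` is strictly increasing in both
arguments. -/
theorem HasUnitLead.mul {x y : Sh lam S} {u v w : List S} (hx : HasUnitLead x u)
    (hy : HasUnitLead y v) (hw : maxMerge u v = w) (hc : IsUnit (shufCount u v w : k)) :
    HasUnitLead (x * y) w := by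
  subst hw
  obtain ⟨c, hc', hx⟩ := hx
  obtain ⟨d, hd, hy⟩ := hy
  refine ⟨c * d * shufCount u v (maxMerge u v), (hc'.mul hd).mul hc, ?_⟩
  have hu : word lam u ∈ wordSpan lam {u} := word_mem_wordSpan rfl
  have hv : word lam v ∈ wordSpan lam {v} := word_mem_wordSpan rfl
  have h1 := Submodule.smul_mem _ (c * d) (word_mul_word_sub_mem (lam := lam) u v)
  have h2 : word lam u * (y - d • word lam v) ∈ lowerSpan lam (maxMerge u v) := by
    refine mul_mem_wordSpan_of_forall ?_ hu hy
    rintro _ rfl v' hv'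
    exact word_mul_word_mem (shortLT_maxMerge_right _ hv')
  have h3 : (x - c • word lam u) * word lam v ∈ lowerSpan lam (maxMerge u v) := by
    refine mul_mem_wordSpan_of_forall ?_ hx hv
    rintro u' hu' _ rfl
    exact word_mul_word_mem (shortLT_maxMerge_left _ hu')
  have h4 : (x - c • word lam u) * (y - d • word lam v) ∈ lowerSpan lam (maxMerge u v) := by
    refine mul_mem_wordSpan_of_forall ?_ hx hy
    rintro u' hu' v' hv'
    exact word_mul_word_mem ((shortLT_maxMerge_left _ hu').trans (shortLT_maxMerge_right _ hv'))
  have h5 := Submodule.add_mem _ (Submodule.add_mem _ (Submodule.add_mem _ h1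
    (Submodule.smul_mem _ c h2)) (Submodule.smul_mem _ d h3)) h4
  -- `x y = (c u + x') (d v + y')`, where `x'` and `y'` are the lower parts.
  convert h5 using 1
  simp only [mul_sub, sub_mul, smul_sub, smul_mul_assoc, mul_smul_comm]
  module

end Leading

/-! ### Base `p` digits and truncated monomials -/

section Digits

/-- The number with the `p`-adic digits `d`. -/
def evalDigits (p : ℕ) (d : ℕ →₀ ℕ) : ℕ := d.sum fun j n => n * p ^ j

/-- The `p`-adic digits of `n`. -/
def digitsOf (p : ℕ) [Fact p.Prime] (n : ℕ) : ℕ →₀ ℕ :=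
  Finsupp.onFinset (Finset.range n) (fun j => n / p ^ j % p) fun j hj => by
    rw [Finset.mem_range]
    have h1 : n / p ^ j ≠ 0 := by
      intro h
      simp [h] at hj
    have h2 : p ^ j ≤ n := by
      by_contra h
      exact h1 (Nat.div_eq_of_lt (by omega))
    exact lt_of_lt_of_le (Nat.lt_pow_self (Fact.out (p := p.Prime)).one_lt) h2

variable {p : ℕ}

theorem evalDigits_eq_sum_range {d : ℕ →₀ ℕ} {N : ℕ} (h : d.support ⊆ Finset.range N) :
    evalDigits p d = ∑ i ∈ Finset.range N, d i * p ^ i :=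
  Finsupp.sum_of_support_subset _ h _ (by simp)

theorem evalDigits_add (d e : ℕ →₀ ℕ) :
    evalDigits p (d + e) = evalDigits p d + evalDigits p e :=
  Finsupp.sum_add_index' (by simp) (by intros; ring)

theorem evalDigits_single (j n : ℕ) : evalDigits p (Finsupp.single j n) = n * p ^ j :=
  Finsupp.sum_single_index (by simp)

theorem sum_digits_div_mod {f : ℕ → ℕ} (hf : ∀ i, f i < p) {N j : ℕ} (hj : j < N) :
    (∑ i ∈ Finset.range N, f i * p ^ i) / p ^ j % p = f j := by
  have hp : 0 < p := (Nat.zero_le _).trans_lt (hf 0)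
  induction j generalizing f N with
  | zero =>
    obtain ⟨N, rfl⟩ : ∃ M, N = M + 1 := ⟨N - 1, by omega⟩
    have : ∑ i ∈ Finset.range N, f (i + 1) * p ^ (i + 1) =
        p * ∑ i ∈ Finset.range N, f (i + 1) * p ^ i := by
      rw [Finset.mul_sum]
      exact Finset.sum_congr rfl fun i _ => by ring
    rw [Finset.sum_range_succ', this]
    simp [Nat.mod_eq_of_lt (hf 0)]
  | succ j ih =>
    obtain ⟨N, rfl⟩ : ∃ M, N = M + 1 := ⟨N - 1, by omega⟩
    have : ∑ i ∈ Finset.range N, f (i + 1) * p ^ (i + 1) =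
        p * ∑ i ∈ Finset.range N, f (i + 1) * p ^ i := by
      rw [Finset.mul_sum]
      exact Finset.sum_congr rfl fun i _ => by ring
    rw [Finset.sum_range_succ', this, pow_succ', ← Nat.div_div_eq_div_mul]
    rw [show (p * ∑ i ∈ Finset.range N, f (i + 1) * p ^ i + f 0 * p ^ 0) / p =
      ∑ i ∈ Finset.range N, f (i + 1) * p ^ i by
        rw [Nat.mul_add_div hp, Nat.div_eq_of_lt (by simpa using hf 0), add_zero]]
    exact ih (fun i => hf (i + 1)) (by omega)

theorem evalDigits_div_mod {d : ℕ →₀ ℕ} (hd : ∀ j, d j < p) (j : ℕ) :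
    evalDigits p d / p ^ j % p = d j := by
  have h : d.support ⊆ Finset.range (max (j + 1) (d.support.sup id + 1)) := fun i hi => by
    have := Finset.le_sup (f := id) hi
    rw [Finset.mem_range]
    simp only [id] at this
    omega
  rw [evalDigits_eq_sum_range h]
  exact sum_digits_div_mod hd (by omega)

theorem evalDigits_injective {d e : ℕ →₀ ℕ} (hd : ∀ j, d j < p) (he : ∀ j, e j < p)
    (h : evalDigits p d = evalDigits p e) : d = e := by
  ext j
  rw [← evalDigits_div_mod hd, ← evalDigits_div_mod he, h]

theorem sum_div_mod_eq_mod (n N : ℕ) :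
    ∑ i ∈ Finset.range N, (n / p ^ i % p) * p ^ i = n % p ^ N := by
  induction N with
  | zero => simp [Nat.mod_one]
  | succ N ih => rw [Finset.sum_range_succ, ih, Nat.mod_pow_succ, mul_comm]

theorem digitsOf_lt [Fact p.Prime] (n j : ℕ) : digitsOf p n j < p :=
  Nat.mod_lt _ (Fact.out (p := p.Prime)).pos

theorem evalDigits_digitsOf [Fact p.Prime] (n : ℕ) : evalDigits p (digitsOf p n) = n := by
  rw [evalDigits_eq_sum_range (N := n) (d := digitsOf p n) Finsupp.support_onFinset_subset]
  change ∑ i ∈ Finset.range n, (n / p ^ i % p) * p ^ i = n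
  rw [sum_div_mod_eq_mod, Nat.mod_eq_of_lt (Nat.lt_pow_self (Fact.out (p := p.Prime)).one_lt)]

theorem evalDigits_ne_zero (hp : 0 < p) {d : ℕ →₀ ℕ} (hd : d ≠ 0) : evalDigits p d ≠ 0 := by
  obtain ⟨j, hj⟩ := Finsupp.ne_iff.1 hd
  intro h
  rw [evalDigits, Finsupp.sum, Finset.sum_eq_zero_iff] at h
  have := h j (Finsupp.mem_support_iff.2 hj)
  have h2 := pow_pos hp j
  rw [Nat.mul_eq_zero] at this
  exact this.elim hj h2.ne'

/-- Adding `p ^ j` to `n` causes no carry if the `j`-th digit of `n` is not the largest one. -/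
theorem not_dvd_choose_add_pow [Fact p.Prime] {n j : ℕ} (h : n / p ^ j % p + 1 < p) :
    ¬ p ∣ (n + p ^ j).choose (p ^ j) := by
  have hp := (Fact.out (p := p.Prime))
  induction j generalizing n with
  | zero =>
    rw [pow_zero, Nat.div_one] at h
    rw [pow_zero, Nat.choose_one_right, Nat.dvd_iff_mod_eq_zero, Nat.add_mod,
      Nat.mod_eq_of_lt hp.one_lt, Nat.mod_eq_of_lt h]
    omega
  | succ j ih =>
    have h1 := Choose.choose_modEq_choose_mod_mul_choose_div_nat (n := n + p ^ (j + 1))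
      (k := p ^ (j + 1)) (p := p)
    rw [pow_succ', Nat.mul_mod_right, Nat.choose_zero_right, one_mul,
      Nat.mul_div_cancel_left _ hp.pos, Nat.add_mul_div_left _ _ hp.pos] at h1
    rw [pow_succ', Nat.dvd_iff_mod_eq_zero, h1, ← Nat.dvd_iff_mod_eq_zero]
    apply ih
    rwa [Nat.div_div_eq_div_mul, ← pow_succ']

end Digits

section Monomials

variable {k : Type*} [CommRing k] {lam : k} {S : Type*} [LinearOrder S] {p : ℕ}

/-- `IsFac p μ w` says that the word `w` is the concatenation, in decreasing order, of the powers
of Lyndon words `l ^ n`, where the `p`-adic digits of `n` are the numbers `μ (l, j)`. -/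
inductive IsFac (p : ℕ) : (Lyn S × ℕ →₀ ℕ) → List S → Prop
  | nil : IsFac p 0 []
  | cons (l : Lyn S) (d : ℕ →₀ ℕ) (hd : ∀ j, d j < p) (hd0 : d ≠ 0) (μ : Lyn S × ℕ →₀ ℕ)
      (v : List S) (hv : v < l) (h : IsFac p μ v) :
      IsFac p (d.mapDomain (Prod.mk l) + μ) (tensorPow l (evalDigits p d) ++ v)

theorem exists_isFac [Fact p.Prime] (w : List S) : ∃ μ, IsFac p μ w := by
  induction hn : w.length using Nat.strong_induction_on generalizing w with
  | _ n ih =>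
    by_cases hw : w = []
    · exact ⟨0, hw ▸ IsFac.nil⟩
    · obtain ⟨l, hl, m, v, hv, rfl⟩ := exists_eq_tensorPow_append hw
      have hl0 := List.length_pos_iff.2 hl.1
      obtain ⟨μ, hμ⟩ := ih v.length (by
        rw [← hn, List.length_append, tensorPow_succ, List.length_append]; omega) v rfl
      have h := IsFac.cons ⟨l, hl⟩ (digitsOf p (m + 1)) (digitsOf_lt _) (fun h => by
        have := evalDigits_digitsOf (p := p) (m + 1)
        rw [h] at this
        simp [evalDigits] at this) μ v hv hμ
      rw [evalDigits_digitsOf] at h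
      exact ⟨_, h⟩

theorem mapDomain_prodMk_apply (l m : Lyn S) (d : ℕ →₀ ℕ) (j : ℕ) :
    d.mapDomain (Prod.mk l) (m, j) = if m = l then d j else 0 := by
  split_ifs with h
  · subst h
    exact Finsupp.mapDomain_apply (Prod.mk_right_injective _) d j
  · refine Finsupp.mapDomain_of_notMem_range d _ ?_
    rintro ⟨i, hi⟩
    exact h (Prod.ext_iff.1 hi).1.symm

/-- No Lyndon factor of `w` is larger than `w`. -/
theorem IsFac.le {μ : Lyn S × ℕ →₀ ℕ} {w : List S} (h : IsFac p μ w) (hp : 0 < p)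
    {m : Lyn S} {j : ℕ} (hm : μ (m, j) ≠ 0) : (m : List S) ≤ w := by
  induction h with
  | nil => simp at hm
  | cons l d hd hd0 μ v hv h ih =>
    have hw : (l : List S) ≤ tensorPow l (evalDigits p d) ++ v := by
      obtain ⟨n, hn⟩ := Nat.exists_eq_succ_of_ne_zero (evalDigits_ne_zero hp hd0)
      rw [hn, tensorPow_succ, List.append_assoc]
      exact le_append_right _ _
    rw [Finsupp.add_apply, mapDomain_prodMk_apply] at hm
    split_ifs at hm with hml
    · exact hml ▸ hw
    · exact (ih (by simpa using hm)).trans (hv.le.trans hw)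

theorem IsFac.lt {μ : Lyn S × ℕ →₀ ℕ} {w : List S} (h : IsFac p μ w) (hp : 0 < p)
    (q : Lyn S × ℕ) : μ q < p := by
  obtain ⟨m, j⟩ := q
  induction h with
  | nil => simpa using hp
  | cons l d hd hd0 μ v hv h ih =>
    rw [Finsupp.add_apply, mapDomain_prodMk_apply]
    split_ifs with hml
    · subst hml
      have : μ (m, j) = 0 := by
        by_contra h0
        exact absurd hv (not_lt.2 (h.le hp h0))
      rw [this]
      exact hd j
    · simpa using ih

/-- A word is smaller than every Lyndon word that is larger than all its Lyndon factors. -/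
theorem IsFac.lt_of_forall {μ : Lyn S × ℕ →₀ ℕ} {w : List S} (h : IsFac p μ w)
    {l : Lyn S} (hl : ∀ m j, μ (m, j) ≠ 0 → (m : List S) < l) : w < l := by
  cases h with
  | nil => exact nil_lt_of_mem_Lyn l.2
  | cons m d hd hd0 μ v hv h =>
    obtain ⟨j, hj⟩ := Finsupp.ne_iff.1 hd0
    have hml : (m : List S) < l := by
      refine hl m j ?_
      rw [Finsupp.add_apply, mapDomain_prodMk_apply, if_pos rfl]
      simp at hj
      omega
    exact tensorPow_append_lt l.2 m.2.1 hml (hv.trans hml) _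

theorem exists_isFac_of_lt {μ : Lyn S × ℕ →₀ ℕ} (h : ∀ q, μ q < p) : ∃ w, IsFac p μ w := by
  classical
  induction hn : μ.support.card using Nat.strong_induction_on generalizing μ with
  | _ n ih =>
    by_cases hμ : μ = 0
    · exact ⟨[], hμ ▸ IsFac.nil⟩
    · obtain ⟨⟨l, i⟩, hl, hmax⟩ := Finset.exists_max_image μ.support
        (fun q => (q.1 : List S)) (Finsupp.support_nonempty_iff.2 hμ)
      set ν := μ.filter fun q => q.1 ≠ l with hν
      have hνle : ∀ q, ν q = if q.1 ≠ l then μ q else 0 := fun q => Finsupp.filter_apply _ _ _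
      have hlt : ν.support.card < n := by
        rw [← hn]
        refine Finset.card_lt_card ⟨?_, fun hsub => ?_⟩
        · rw [hν, Finsupp.support_filter]
          exact Finset.filter_subset _ _
        · have := hsub hl
          rw [Finsupp.mem_support_iff, hνle] at this
          simp at this
      obtain ⟨v, hv⟩ := ih _ hlt (μ := ν) (fun q => by
        rw [hνle]
        split_ifs
        · exact h q
        · exact (Nat.zero_le _).trans_lt (h q)) rfl
      set d := μ.comapDomain (Prod.mk l) (Prod.mk_right_injective l).injOn with hd
      have hdj : ∀ j, d j = μ (l, j) := fun j => rfl
      have hvl : v < l := hv.lt_of_forall fun m j hm => by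
        rw [hνle] at hm
        split_ifs at hm with hml
        · refine lt_of_le_of_ne (hmax (m, j) (Finsupp.mem_support_iff.2 hm)) fun h => hml ?_
          exact Subtype.ext h
        · exact absurd rfl hm
      have hfac := IsFac.cons l d (fun j => h (l, j)) (fun h0 => by
        have := hdj i
        rw [h0] at this
        exact (Finsupp.mem_support_iff.1 hl) this.symm) ν v hvl hv
      have : d.mapDomain (Prod.mk l) + ν = μ := by
        ext ⟨m, j⟩
        rw [Finsupp.add_apply, mapDomain_prodMk_apply, hνle]
        by_cases hml : m = l
        · simp [hml, hdj]
        · simp [hml]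
      exact ⟨_, this ▸ hfac⟩

theorem IsFac.unique {μ ν : Lyn S × ℕ →₀ ℕ} {w : List S} (hp : 0 < p) (h : IsFac p μ w)
    (h' : IsFac p ν w) : μ = ν := by
  induction h generalizing ν with
  | nil =>
    generalize hw : ([] : List S) = w at h'
    cases h' with
    | nil => rfl
    | cons l d hd hd0 μ v hv h =>
      obtain ⟨n, hn⟩ := Nat.exists_eq_succ_of_ne_zero (evalDigits_ne_zero hp hd0)
      rw [hn, tensorPow_succ] at hw
      simp [l.2.1] at hw
  | cons l d hd hd0 μ v hv h ih =>
    obtain ⟨n, hn⟩ := Nat.exists_eq_succ_of_ne_zero (evalDigits_ne_zero hp hd0)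
    generalize hw : tensorPow (l : List S) (evalDigits p d) ++ v = w at h'
    cases h' with
    | nil =>
      rw [hn, tensorPow_succ] at hw
      simp [l.2.1] at hw
    | cons l' d' hd' hd0' μ' v' hv' h' =>
      obtain ⟨n', hn'⟩ := Nat.exists_eq_succ_of_ne_zero (evalDigits_ne_zero hp hd0')
      rw [hn, hn'] at hw
      obtain ⟨h1, h2, h3⟩ := tensorPow_append_injective l.2 l'.2 hv hv' hw
      have h4 : d = d' := evalDigits_injective hd hd' (by omega)
      subst h3 h4
      rw [Subtype.ext h1, ih h']

variable [CommSemigroup S]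

theorem hasUnitLead_digits [Fact p.Prime] (hk : ∀ n : ℕ, ¬ p ∣ n → IsUnit (n : k))
    {y : ℕ → Sh lam S} {l : List S} (hl : l ∈ Lyn S)
    (hy : ∀ j, HasUnitLead (y j) (tensorPow l (p ^ j))) {d : ℕ →₀ ℕ} (hd : ∀ j, d j < p) :
    HasUnitLead (d.prod fun j n => y j ^ n) (tensorPow l (evalDigits p d)) := by
  induction hn : d.degree generalizing d with
  | zero =>
    rw [Finsupp.degree_eq_zero_iff] at hn
    subst hn
    exact hasUnitLead_word (lam := lam) ([] : List S)
  | succ n ih =>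
    have hd0 : d ≠ 0 := by
      rintro rfl
      simp at hn
    obtain ⟨j, hj⟩ := Finsupp.ne_iff.1 hd0
    obtain ⟨e, rfl⟩ : ∃ e, d = e + Finsupp.single j 1 :=
      ⟨d - Finsupp.single j 1, (Finsupp.sub_add_single_one_cancel hj).symm⟩
    have he : ∀ i, e i < p := fun i => lt_of_le_of_lt (by simp) (hd i)
    rw [map_add, Finsupp.degree_single] at hn
    have h1 := ih he (by omega)
    rw [Finsupp.prod_add_index' (by simp) (by intros; rw [pow_add]),
      Finsupp.prod_single_index (by simp), pow_one, evalDigits_add, evalDigits_single, one_mul]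
    refine h1.mul (hy j) (maxMerge_tensorPow_tensorPow hl _ _) ?_
    rw [shufCount_tensorPow_tensorPow hl, Nat.choose_symm_add]
    apply hk
    apply not_dvd_choose_add_pow
    rw [evalDigits_div_mod he]
    simpa using hd j

theorem IsFac.hasUnitLead [Fact p.Prime] (hk : ∀ n : ℕ, ¬ p ∣ n → IsUnit (n : k))
    {y : Lyn S × ℕ → Sh lam S}
    (hy : ∀ q, HasUnitLead (y q) (tensorPow q.1 (p ^ q.2))) {μ : Lyn S × ℕ →₀ ℕ}
    {w : List S} (h : IsFac p μ w) : HasUnitLead (μ.prod fun q n => y q ^ n) w := by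
  induction h with
  | nil => exact hasUnitLead_word (lam := lam) ([] : List S)
  | cons l d hd hd0 μ v hv h ih =>
    rw [Finsupp.prod_add_index' (by simp) (by intros; rw [pow_add]),
      Finsupp.prod_mapDomain_index_inj (Prod.mk_right_injective l)]
    refine (hasUnitLead_digits hk l.2 (fun j => hy (l, j)) hd).mul ih
      (maxMerge_tensorPow_of_lt l.2 hv _) ?_
    rw [shufCount_tensorPow_of_lt l.2 hv]
    simp

/-- If `S` is well-ordered and `y (l, j)` has leading word `l ^ (p ^ j)`, for `l` Lyndon and
`j ≥ 0`, then the monomials in the `y (l, j)` with all exponents less than `p` form a basis of the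
mixable shuffle algebra: their leading words run through all words, without repetition. -/
theorem bijective_restrictDegree [Fact p.Prime] [Nontrivial k] [WellFoundedLT S]
    (hk : ∀ n : ℕ, ¬ p ∣ n → IsUnit (n : k)) {y : Lyn S × ℕ → Sh lam S}
    (hy : ∀ q, HasUnitLead (y q) (tensorPow q.1 (p ^ q.2))) :
    Function.Bijective
      ((aeval y).toLinearMap ∘ₗ (restrictDegree (Lyn S × ℕ) k (p - 1)).subtype) := by
  have hp := (Fact.out (p := p.Prime)).pos
  have hmon : ∀ (μ : Lyn S × ℕ →₀ ℕ) (c : k),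
      aeval y (monomial μ c) = c • μ.prod fun q n => y q ^ n := fun μ c => by
    rw [aeval_monomial, Algebra.smul_def]
  refine ⟨(injective_iff_map_eq_zero _).2 ?_, fun x => ?_⟩
  · rintro ⟨f, hf⟩ hf0
    replace hf0 : aeval y f = 0 := hf0
    rw [mem_restrictDegree] at hf
    refine Subtype.ext (show f = 0 from ?_)
    by_contra hne
    have hex : ∀ μ ∈ f.support, ∃ w, IsFac p μ w := fun μ hμ =>
      exists_isFac_of_lt fun q => by have := hf μ hμ q; omega
    choose! W hW using hex
    -- The largest of the leading words of the monomials of `f` does not cancel.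
    obtain ⟨ν, hν, hmax⟩ := Finset.exists_max_image f.support
      (fun μ => toLex ((W μ).length, W μ)) (support_nonempty.2 hne)
    have h0 : coeffWord lam (W ν) (aeval y f) = f.coeff ν *
        coeffWord lam (W ν) (ν.prod fun q n => y q ^ n) := by
      conv_lhs => rw [f.as_sum]
      rw [map_sum, map_sum, Finset.sum_eq_single ν]
      · rw [hmon, map_smul, smul_eq_mul]
      · intro μ hμ hμν
        rw [hmon, map_smul]
        have hlt : ShortLT (W μ) (W ν) := by
          have h1 := (hmax μ hμ).lt_of_ne fun h => hμν ?_
          · rw [Prod.Lex.toLex_lt_toLex] at h1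
            exact shortLT_iff.2 h1
          · have h2 : W μ = W ν := (Prod.ext_iff.1 (toLex.injective h)).2
            exact (hW μ hμ).unique hp (h2 ▸ hW ν hν)
        rw [((hW μ hμ).hasUnitLead hk hy).coeff_eq_zero hlt, smul_zero]
      · intro h
        exact absurd hν h
    rw [hf0, map_zero] at h0
    rw [mem_support_iff] at hν
    exact hν ((((hW ν (mem_support_iff.2 hν)).hasUnitLead hk hy).isUnit_coeff.mul_left_eq_zero).1
      h0.symm)
  · suffices h : ∀ w, word lam w ∈ LinearMap.range
        ((aeval y).toLinearMap ∘ₗ (restrictDegree (Lyn S × ℕ) k (p - 1)).subtype) by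
      have h' := Submodule.span_le.2 (Set.range_subset_iff.2 h)
      rw [span_word_eq_top] at h'
      exact h' Submodule.mem_top
    intro w
    induction w using (List.Shortlex.wf (r := ((· < ·) : S → S → Prop)) wellFounded_lt).induction
    next w ih =>
    obtain ⟨μ, hμ⟩ := exists_isFac (p := p) w
    obtain ⟨c, hc, hx⟩ := hμ.hasUnitLead hk hy
    rw [lowerSpan, wordSpan_eq_span] at hx
    have hx' := Submodule.span_le.2 (Set.image_subset_iff.2 fun v hv => ih v hv) hx
    have hm : (μ.prod fun q n => y q ^ n) ∈ LinearMap.range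
        ((aeval y).toLinearMap ∘ₗ (restrictDegree (Lyn S × ℕ) k (p - 1)).subtype) := by
      refine ⟨⟨monomial μ 1, ?_⟩, ?_⟩
      · rw [mem_restrictDegree]
        intro ν hν i
        rw [Finset.mem_singleton.1 (support_monomial_subset hν)]
        exact Nat.le_sub_one_of_lt (hμ.lt hp i)
      · change aeval y (monomial μ 1) = _
        rw [hmon, one_smul]
    have h1 := Submodule.sub_mem _ hm hx'
    rw [sub_sub_cancel] at h1
    exact (Submodule.smul_mem_iff_of_isUnit _ hc).1 h1

end Monomials

/-! ### The Frobenius endomorphism and `p`-adic closures of ideals -/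

section SemigroupPowers

variable {S : Type*} [CommSemigroup S]

theorem coe_sgPow (g : S) {n : ℕ} (hn : n ≠ 0) :
    ((sgPow g n : S) : WithOne S) = (g : WithOne S) ^ n := by
  obtain ⟨n, rfl⟩ := Nat.exists_eq_succ_of_ne_zero hn
  induction n with
  | zero => simp [sgPow]
  | succ n ih =>
    have h : sgPow g (n + 1 + 1) = sgPow g (n + 1) * g := by
      simp only [sgPow, Nat.add_sub_cancel, Function.iterate_succ_apply']
    rw [Nat.succ_eq_add_one, h, WithOne.coe_mul, ih (by omega), ← pow_succ]

theorem sgPow_one (g : S) : sgPow g 1 = g := rfl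

theorem mul_sgPow (g : S) {n : ℕ} (hn : n ≠ 0) : g * sgPow g n = sgPow g (n + 1) := by
  apply WithOne.coe_injective
  rw [WithOne.coe_mul, coe_sgPow g hn, coe_sgPow g (by omega), pow_succ']

theorem sgPow_sgPow (g : S) {m n : ℕ} (hm : m ≠ 0) (hn : n ≠ 0) :
    sgPow (sgPow g m) n = sgPow g (m * n) := by
  apply WithOne.coe_injective
  rw [coe_sgPow _ hn, coe_sgPow g hm, coe_sgPow g (Nat.mul_ne_zero hm hn), pow_mul]

theorem length_letterPow (p : ℕ) (w : List S) : (letterPow p w).length = w.length :=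
  List.length_map _

theorem letterPow_cons (p : ℕ) (g : S) (w : List S) :
    letterPow p (g :: w) = sgPow g p :: letterPow p w := rfl

theorem letterPow_append (p : ℕ) (u v : List S) :
    letterPow p (u ++ v) = letterPow p u ++ letterPow p v := List.map_append

theorem letterPow_tensorPow (p : ℕ) (w : List S) (n : ℕ) :
    letterPow p (tensorPow w n) = tensorPow (letterPow p w) n := by
  induction n with
  | zero => rfl
  | succ n ih => rw [tensorPow_succ, tensorPow_succ, letterPow_append, ih]

theorem letterPow_letterPow {m n : ℕ} (hm : m ≠ 0) (hn : n ≠ 0) (w : List S) :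
    letterPow n (letterPow m w) = letterPow (m * n) w := by
  simp only [letterPow, List.map_map]
  exact List.map_congr_left fun g _ => sgPow_sgPow g hm hn

theorem letterPow_one (w : List S) : letterPow 1 w = w := by
  simp [letterPow, sgPow_one]

end SemigroupPowers

section Frobenius

variable {k : Type*} [CommRing k] {lam : k} {S : Type*}

/-- The operator `w ↦ a ⊗ w` on the mixable shuffle algebra. -/
def consLin (lam : k) (a : S) : Sh lam S →ₗ[k] Sh lam S :=
  (prepend a : (List S →₀ k) →ₗ[k] (List S →₀ k))

theorem consLin_word (a : S) (w : List S) : consLin lam a (word lam w) = word lam (a :: w) :=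
  prepend_single a w 1

variable [CommSemigroup S]

theorem consLin_mul_consLin (a b : S) (x y : Sh lam S) :
    consLin lam a x * consLin lam b y =
      consLin lam a (x * consLin lam b y) + consLin lam b (consLin lam a x * y) +
        lam • consLin lam (a * b) (x * y) :=
  mulLin_prepend lam a b x y

theorem sum_choose_succ_nsmul {M : Type*} [AddCommGroup M] (T : ℕ → M) (n : ℕ) :
    ∑ j ∈ Finset.range (n + 1 + 1), (n + 1 + 1).choose (j + 1) • T j =
      T 0 + ∑ j ∈ Finset.range (n + 1), (n + 1).choose (j + 1) • (T j + T (j + 1)) := by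
  have h1 := Finset.sum_range_succ' (fun j => (n + 1).choose j • T j) (n + 1)
  have h2 := Finset.sum_range_succ (fun j => (n + 1).choose (j + 1) • T j) (n + 1)
  simp only [Nat.choose_succ_succ (n + 1), Nat.succ_eq_add_one, add_smul, Finset.sum_add_distrib,
    h1, h2, smul_add, Nat.choose_succ_self, zero_smul, Nat.choose_zero_right, one_smul]
  abel

/-- The powers of `a ⊗ x`; if `n + 1` is the prime `p`, all terms but the last one are divisible
by `p`. -/
theorem consLin_pow (a : S) (x : Sh lam S) (n : ℕ) :
    consLin lam a x ^ (n + 1) = ∑ j ∈ Finset.range (n + 1), (n + 1).choose (j + 1) •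
      lam ^ j • consLin lam (sgPow a (j + 1)) (x ^ (j + 1) * consLin lam a x ^ (n - j)) := by
  induction n with
  | zero => simp [sgPow_one]
  | succ n ih =>
    set P := consLin lam a x with hP
    set T : ℕ → Sh lam S := fun j =>
      lam ^ j • consLin lam (sgPow a (j + 1)) (x ^ (j + 1) * P ^ (n + 1 - j)) with hT
    have h1 : P ^ (n + 1 + 1) = T 0 + ∑ j ∈ Finset.range (n + 1),
        (n + 1).choose (j + 1) • (T j + T (j + 1)) := by
      have h2 : ∀ j ∈ Finset.range (n + 1), P * ((n + 1).choose (j + 1) •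
          lam ^ j • consLin lam (sgPow a (j + 1)) (x ^ (j + 1) * P ^ (n - j))) =
          consLin lam a (x * ((n + 1).choose (j + 1) •
          lam ^ j • consLin lam (sgPow a (j + 1)) (x ^ (j + 1) * P ^ (n - j)))) +
            (n + 1).choose (j + 1) • (T j + T (j + 1)) := by
        intro j hj
        rw [Finset.mem_range] at hj
        rw [mul_smul_comm, mul_smul_comm, hP, consLin_mul_consLin, ← hP,
          mul_sgPow a (Nat.succ_ne_zero j), mul_smul_comm, mul_smul_comm, map_nsmul, map_smul,
          ← smul_add]
        simp only [hT]
        rw [show n + 1 - j = (n - j) + 1 by omega, show n + 1 - (j + 1) = n - j by omega,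
          show P * (x ^ (j + 1) * P ^ (n - j)) = x ^ (j + 1) * P ^ (n - j + 1) by ring,
          show x * (x ^ (j + 1) * P ^ (n - j)) = x ^ (j + 1 + 1) * P ^ (n - j) by ring,
          pow_succ lam, mul_smul]
        simp only [smul_add, add_assoc, Nat.succ_eq_add_one]
      rw [pow_succ', ih, Finset.mul_sum, Finset.sum_congr rfl h2, Finset.sum_add_distrib,
        ← map_sum, ← Finset.mul_sum, ← ih]
      simp [hT, sgPow_one]
    rw [h1]
    exact (sum_choose_succ_nsmul T n).symm

variable {p : ℕ}

theorem dvd_consLin {x : Sh lam S} (a : S) (h : (p : Sh lam S) ∣ x) :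
    (p : Sh lam S) ∣ consLin lam a x := by
  obtain ⟨y, rfl⟩ := h
  rw [← nsmul_eq_mul, map_nsmul, nsmul_eq_mul]
  exact dvd_mul_right _ _

theorem natCast_dvd_smul {c : k} (hc : (p : k) ∣ c) (x : Sh lam S) : (p : Sh lam S) ∣ c • x := by
  obtain ⟨d, rfl⟩ := hc
  rw [mul_smul, Nat.cast_smul_eq_nsmul, nsmul_eq_mul]
  exact dvd_mul_right _ _

variable [Fact p.Prime]

theorem dvd_consLin_pow_sub (a : S) (x : Sh lam S) :
    (p : Sh lam S) ∣ consLin lam a x ^ p - lam ^ (p - 1) • consLin lam (sgPow a p) (x ^ p) := by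
  have hp := (Fact.out (p := p.Prime))
  obtain ⟨n, hn⟩ := Nat.exists_eq_succ_of_ne_zero hp.ne_zero
  rw [Nat.succ_eq_add_one] at hn
  have h := consLin_pow a x n
  rw [Finset.sum_range_succ, ← hn] at h
  rw [h, hn, Nat.choose_self, one_smul, Nat.sub_self, pow_zero, mul_one, Nat.add_sub_cancel,
    add_sub_cancel_right, ← hn]
  refine Finset.dvd_sum fun j hj => ?_
  rw [Finset.mem_range] at hj
  rw [nsmul_eq_mul]
  exact Dvd.dvd.mul_right (Nat.cast_dvd_cast (hp.dvd_choose_self (by omega) (by omega))) _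

/-- Modulo `p`, the Frobenius endomorphism of the mixable shuffle algebra raises all letters of a
word to the `p`-th power. -/
theorem dvd_word_pow_sub (hlam : (p : k) ∣ lam ^ (p - 1) - 1) (w : List S) :
    (p : Sh lam S) ∣ word lam w ^ p - word lam (letterPow p w) := by
  induction w with
  | nil =>
    have : word lam ([] : List S) = 1 := rfl
    rw [show letterPow p ([] : List S) = [] from rfl, this, one_pow, sub_self]
    exact dvd_zero _
  | cons a w ih =>
    have h1 := dvd_consLin_pow_sub (p := p) a (word lam w)
    have h2 := natCast_dvd_smul hlam (consLin lam (sgPow a p) (word lam w ^ p))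
    have h3 := dvd_consLin (sgPow a p) ih
    rw [letterPow_cons, ← consLin_word, ← consLin_word]
    convert dvd_add (dvd_add h1 h2) h3 using 1
    rw [map_sub, sub_smul, one_smul]
    abel

end Frobenius

section Closure

theorem mem_padicClosure_iff {R : Type*} [CommRing R] {p : ℕ} {I : Ideal R} {a : R} :
    a ∈ padicClosure p I ↔ ∀ n : ℕ, ∃ i ∈ I, ∃ b, a = i + (p : R) ^ n * b := by
  simp only [padicClosure, Ideal.mem_iInf, Submodule.mem_sup, Ideal.mem_span_singleton]
  refine forall_congr' fun n => ?_
  constructor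
  · rintro ⟨i, hi, _, ⟨b, rfl⟩, rfl⟩
    exact ⟨i, hi, b, rfl⟩
  · rintro ⟨i, hi, b, rfl⟩
    exact ⟨i, hi, _, ⟨b, rfl⟩, rfl⟩

variable {k A Y : Type*} [CommRing k] [CommRing A] [Algebra k A] {p : ℕ}
  {φ : MvPolynomial Y k →ₐ[k] A} {I : Ideal (MvPolynomial Y k)}

theorem map_eq_zero_of_mem_padicClosure (hsep : ∀ a : A, (∀ n : ℕ, (p : A) ^ n ∣ a) → a = 0)
    (hI : ∀ f ∈ I, φ f = 0) {a : MvPolynomial Y k} (ha : a ∈ padicClosure p I) : φ a = 0 := by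
  refine hsep _ fun n => ?_
  obtain ⟨i, hi, b, rfl⟩ := mem_padicClosure_iff.1 ha n
  rw [map_add, hI i hi, zero_add, map_mul, map_pow, map_natCast]
  exact dvd_mul_right _ _

variable [Fact p.Prime]

/-- Modulo `I` and `p`, the relations `X y ^ p = c y * X y` reduce every polynomial to one with all
exponents less than `p`. -/
theorem exists_restrictDegree_of_rel (c : Y → k)
    (hrel : ∀ y, X y ^ p - C (c y) * X y ∈ I ⊔ Ideal.span {(p : MvPolynomial Y k)})
    (f : MvPolynomial Y k) :
    ∃ m ∈ restrictDegree Y k (p - 1), ∃ i ∈ I, ∃ g, f = m + i + (p : MvPolynomial Y k) * g := by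
  set J := I ⊔ Ideal.span {(p : MvPolynomial Y k)} with hJ
  have hp := (Fact.out (p := p.Prime)).two_le
  suffices h : restrictDegree Y k (p - 1) ⊔ J.restrictScalars k = ⊤ by
    obtain ⟨m, hm, j, hj, h⟩ := Submodule.mem_sup.1 (h ▸ Submodule.mem_top : f ∈ _)
    obtain ⟨i, hi, b, hb, h'⟩ := Submodule.mem_sup.1 (Submodule.restrictScalars_mem k J j |>.1 hj)
    obtain ⟨g, rfl⟩ := Ideal.mem_span_singleton.1 hb
    exact ⟨m, hm, i, hi, g, by rw [← h, ← h', add_assoc]⟩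
  suffices h : ∀ (n : ℕ) (μ : Y →₀ ℕ) (r : k), μ.degree = n →
      monomial μ r ∈ restrictDegree Y k (p - 1) ⊔ J.restrictScalars k by
    refine eq_top_iff.2 fun f _ => ?_
    rw [f.as_sum]
    exact Submodule.sum_mem _ fun μ _ => h _ μ _ rfl
  intro n
  induction n using Nat.strong_induction_on with
  | _ n ih =>
    intro μ r hμ
    by_cases hlt : ∀ y, μ y ≤ p - 1
    · refine Submodule.mem_sup_left ?_
      rw [mem_restrictDegree]
      intro ν hν y
      rw [Finset.mem_singleton.1 (support_monomial_subset hν)]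
      exact hlt y
    · push Not at hlt
      obtain ⟨y, hy⟩ := hlt
      obtain ⟨ν, rfl⟩ : ∃ ν, μ = ν + Finsupp.single y p :=
        ⟨μ - Finsupp.single y p, (tsub_add_cancel_of_le (Finsupp.single_le_iff.2 (by omega))).symm⟩
      rw [map_add, Finsupp.degree_single] at hμ
      have h1 := ih (ν.degree + 1) (by omega) (ν + Finsupp.single y 1) (r * c y) (by simp)
      have h2 : monomial ν r * (X y ^ p - C (c y) * X y) ∈
          restrictDegree Y k (p - 1) ⊔ J.restrictScalars k :=
        Submodule.mem_sup_right (J.mul_mem_left _ (hrel y))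
      have h3 : monomial (ν + Finsupp.single y p) r =
          monomial (ν + Finsupp.single y 1) (r * c y) +
            monomial ν r * (X y ^ p - C (c y) * X y) := by
        rw [mul_sub, X_pow_eq_monomial, monomial_mul, mul_one, C_mul_X_eq_monomial, monomial_mul]
        abel
      rw [h3]
      exact Submodule.add_mem _ h1 h2

/-- If the polynomials with all exponents less than `p` are mapped bijectively onto `A`, and every
`X y ^ p` is congruent to a multiple of `X y` modulo `I` and `p`, then the kernel lies in the
`p`-adic closure of `I`. -/
theorem mem_padicClosure_of_map_eq_zero
    (hbij : Function.Bijective (φ.toLinearMap ∘ₗ (restrictDegree Y k (p - 1)).subtype))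
    (hI : ∀ f ∈ I, φ f = 0) (c : Y → k)
    (hrel : ∀ y, X y ^ p - C (c y) * X y ∈ I ⊔ Ideal.span {(p : MvPolynomial Y k)})
    {a : MvPolynomial Y k} (ha : φ a = 0) : a ∈ padicClosure p I := by
  have key : ∀ (n : ℕ) (f : MvPolynomial Y k), ∃ m ∈ restrictDegree Y k (p - 1), ∃ i ∈ I, ∃ g,
      f = m + i + (p : MvPolynomial Y k) ^ n * g := by
    intro n
    induction n with
    | zero => exact fun f => ⟨0, Submodule.zero_mem _, 0, I.zero_mem, f, by simp⟩
    | succ n ih =>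
      intro f
      obtain ⟨m, hm, i, hi, g, rfl⟩ := ih f
      obtain ⟨m', hm', i', hi', g', rfl⟩ := exists_restrictDegree_of_rel c hrel g
      refine ⟨m + (p ^ n) • m', Submodule.add_mem _ hm (nsmul_mem hm' _),
        i + (p : MvPolynomial Y k) ^ n * i', I.add_mem hi (I.mul_mem_left _ hi'), g', ?_⟩
      rw [nsmul_eq_mul, Nat.cast_pow]
      ring
  refine mem_padicClosure_iff.2 fun n => ?_
  obtain ⟨m, hm, i, hi, g, rfl⟩ := key n a
  obtain ⟨⟨m', hm'⟩, h'⟩ := hbij.2 (φ g)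
  replace h' : φ m' = φ g := h'
  have h1 : φ (m + (p ^ n) • m') = 0 := by
    rw [map_add, map_add, hI i hi, add_zero] at ha
    rw [map_add, nsmul_eq_mul, map_mul, h', ← ha, map_mul, Nat.cast_pow]
  have h2 : m + (p ^ n) • m' = 0 := by
    have := (injective_iff_map_eq_zero _).1 hbij.1
      ⟨m + (p ^ n) • m', Submodule.add_mem _ hm (nsmul_mem hm' _)⟩ h1
    exact congrArg Subtype.val this
  refine ⟨i, hi, g - m', ?_⟩
  rw [nsmul_eq_mul, Nat.cast_pow] at h2
  linear_combination h2

end Closure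

section Rename

variable {k A Y : Type*} [CommRing k] [CommRing A] [Algebra k A]

theorem rename_mem_restrictDegree {Z : Type*} (σ : Y ≃ Z) {n : ℕ} {f : MvPolynomial Y k}
    (hf : f ∈ restrictDegree Y k n) : rename σ f ∈ restrictDegree Z k n := by
  classical
  rw [mem_restrictDegree] at *
  intro s hs z
  rw [support_rename_of_injective σ.injective, Finset.mem_image] at hs
  obtain ⟨t, ht, rfl⟩ := hs
  obtain ⟨y, rfl⟩ := σ.surjective z
  rw [Finsupp.mapDomain_apply σ.injective]
  exact hf t ht y

theorem bijective_restrictDegree_of_equiv {Z : Type*} (σ : Y ≃ Z) {n : ℕ} {g : Z → A}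
    (h : Function.Bijective
      ((aeval (R := k) (g ∘ σ)).toLinearMap ∘ₗ (restrictDegree Y k n).subtype)) :
    Function.Bijective ((aeval (R := k) g).toLinearMap ∘ₗ (restrictDegree Z k n).subtype) := by
  refine ⟨(injective_iff_map_eq_zero _).2 ?_, fun x => ?_⟩
  · rintro ⟨f, hf⟩ hf0
    replace hf0 : aeval g f = 0 := hf0
    have h1 := (injective_iff_map_eq_zero _).1 h.1
      ⟨rename σ.symm f, rename_mem_restrictDegree σ.symm hf⟩ (by
        change aeval (g ∘ σ) (rename σ.symm f) = 0
        rw [aeval_rename, Function.comp_assoc, Equiv.self_comp_symm, Function.comp_id, hf0])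
    have h2 : rename σ.symm f = 0 := congrArg Subtype.val h1
    exact Subtype.ext (rename_injective _ σ.symm.injective (by rw [h2]; simp))
  · obtain ⟨⟨f, hf⟩, rfl⟩ := h.2 x
    exact ⟨⟨rename σ f, rename_mem_restrictDegree σ hf⟩, aeval_rename _ _ _⟩

end Rename

/-! ### Semigroups with `g ^ (p ^ 2) = g ^ p` -/

section Padic

variable {p : ℕ} [Fact p.Prime]

theorem isUnit_natCast_of_not_dvd {n : ℕ} (h : ¬ p ∣ n) : IsUnit (n : ℤ_[p]) := by
  rw [PadicInt.isUnit_iff]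
  refine le_antisymm (PadicInt.norm_le_one _) (not_lt.1 fun h' => h ?_)
  have := (PadicInt.norm_int_lt_one_iff_dvd (p := p) (n : ℤ)).1 (by exact_mod_cast h')
  exact_mod_cast this

theorem dvd_pow_sub_one {lam : ℤ_[p]} (hlam : IsUnit lam) :
    (p : ℤ_[p]) ∣ lam ^ (p - 1) - 1 := by
  rw [← Ideal.mem_span_singleton, ← PadicInt.maximalIdeal_eq_span_p, ← PadicInt.ker_toZMod,
    RingHom.mem_ker, map_sub, map_pow, map_one, sub_eq_zero]
  exact ZMod.pow_card_sub_one_eq_one (hlam.map _).ne_zero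

theorem eq_zero_of_forall_pow_dvd {a : ℤ_[p]} (h : ∀ n : ℕ, (p : ℤ_[p]) ^ n ∣ a) : a = 0 := by
  by_contra ha
  obtain ⟨n, hn⟩ := FiniteMultiplicity.of_not_isUnit (PadicInt.prime_p (p := p)).not_isUnit ha
  exact hn (h _)

variable {S : Type*} [CommSemigroup S] {lam : ℤ_[p]}

theorem coeffWord_natCast_mul (w : List S) (n : ℕ) (x : Sh lam S) :
    coeffWord lam w ((n : Sh lam S) * x) = n * coeffWord lam w x := by
  rw [← nsmul_eq_mul, map_nsmul, nsmul_eq_mul]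

theorem Sh_eq_zero_of_forall_pow_dvd {x : Sh lam S} (h : ∀ n : ℕ, (p : Sh lam S) ^ n ∣ x) :
    x = 0 := by
  refine Sh_ext fun w => ?_
  rw [map_zero]
  refine eq_zero_of_forall_pow_dvd fun n => ?_
  obtain ⟨y, rfl⟩ := h n
  rw [show (p : Sh lam S) ^ n = ((p ^ n : ℕ) : Sh lam S) from (Nat.cast_pow p n).symm,
    coeffWord_natCast_mul, Nat.cast_pow]
  exact dvd_mul_right _ _

end Padic

section ClassJ

theorem letterPow_tensorPow_eq_iff {S : Type*} [CommSemigroup S] {p : ℕ} {w : List S} {n : ℕ}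
    (hn : n ≠ 0) :
    letterPow p (tensorPow w n) = tensorPow w n ↔ letterPow p w = w := by
  obtain ⟨n, rfl⟩ := Nat.exists_eq_succ_of_ne_zero hn
  rw [letterPow_tensorPow]
  refine ⟨fun h => ?_, fun h => by rw [h]⟩
  rw [tensorPow_succ, tensorPow_succ] at h
  exact (List.append_inj h (length_letterPow p w)).1

variable {p : ℕ} [Fact p.Prime] {S : Type*} [CommSemigroup S] [LinearOrder S]

theorem IsClassJ.letterPow_letterPow (hS : IsClassJ p S) (w : List S) :
    letterPow p (letterPow p w) = letterPow p w := by
  have hp := (Fact.out (p := p.Prime)).ne_zero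
  rw [MixShuffle.letterPow_letterPow hp hp, ← sq]
  exact List.map_congr_left fun g _ => hS.pow_sq g

/-- Raising letters to the `p`-th power makes a word smaller: each letter that changes is replaced
by one with `g ^ p = g`. -/
theorem IsClassJ.letterPow_lt (hS : IsClassJ p S) {w : List S} (hw : letterPow p w ≠ w) :
    letterPow p w < w := by
  have hp := (Fact.out (p := p.Prime)).ne_zero
  induction w with
  | nil => exact absurd rfl hw
  | cons g w ih =>
    rw [letterPow_cons] at *
    by_cases hg : sgPow g p = g
    · rw [hg] at hw ⊢
      exact cons_lt_cons_of_lt g (ih fun h => hw (by rw [h]))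
    · refine List.cons_lt_cons_iff.2 (Or.inl (hS.lt _ _ ?_ hg))
      rw [sgPow_sgPow g hp hp, ← sq, hS.pow_sq]

variable {lam : ℤ_[p]}

open Classical in
/-- The element of `EETL` with leading word `l ^ (p ^ j)`. -/
def eetlElem (lam : ℤ_[p]) (q : Lyn S × ℕ) : EETL p lam S :=
  if h : letterPow p (q.1 : List S) = q.1 then
    ⟨word lam (tensorPow q.1 (p ^ q.2)), Or.inl ⟨_, ⟨q.1, ⟨q.1.2, h⟩, q.2, rfl⟩, rfl⟩⟩
  else
    ⟨word lam (tensorPow q.1 (p ^ q.2)) - word lam (letterPow p (tensorPow q.1 (p ^ q.2))),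
      Or.inr ⟨_, ⟨q.1, ⟨q.1.2, h⟩, q.2, rfl⟩, rfl⟩⟩

theorem IsClassJ.hasUnitLead_eetlElem (hS : IsClassJ p S) (q : Lyn S × ℕ) :
    HasUnitLead (eetlElem lam q).1 (tensorPow q.1 (p ^ q.2)) := by
  rw [eetlElem]
  split_ifs with h
  · exact hasUnitLead_word _
  · refine ⟨1, isUnit_one, ?_⟩
    rw [one_smul, sub_sub_cancel_left]
    refine Submodule.neg_mem _ (word_mem_lowerSpan (shortLT_iff.2 (Or.inr
      ⟨length_letterPow _ _, hS.letterPow_lt ?_⟩)))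
    rwa [Ne, letterPow_tensorPow_eq_iff (pow_ne_zero _ (Fact.out (p := p.Prime)).ne_zero)]

theorem IsClassJ.bijective_eetlElem (hS : IsClassJ p S) :
    Function.Bijective (eetlElem lam : Lyn S × ℕ → EETL p lam S) := by
  have hp := (Fact.out (p := p.Prime))
  refine ⟨fun q q' h => ?_, fun x => ?_⟩
  · have h1 := (h ▸ hS.hasUnitLead_eetlElem q :
      HasUnitLead (eetlElem lam q').1 (tensorPow q.1 (p ^ q.2))).unique
        (hS.hasUnitLead_eetlElem q')
    obtain ⟨h2, h3⟩ := tensorPow_injective q.1.2 q'.1.2 (pow_ne_zero _ hp.ne_zero)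
      (pow_ne_zero _ hp.ne_zero) h1
    exact Prod.ext (Subtype.ext h2) (Nat.pow_right_injective hp.two_le h3)
  · obtain ⟨x, ⟨v, ⟨w, hw, i, rfl⟩, rfl⟩ | ⟨v, ⟨w, hw, i, rfl⟩, rfl⟩⟩ := x
    · refine ⟨(⟨w, hw.1⟩, i), Subtype.ext ?_⟩
      rw [eetlElem, dif_pos hw.2]
    · refine ⟨(⟨w, hw.1⟩, i), Subtype.ext ?_⟩
      rw [eetlElem, dif_neg hw.2]

theorem IsClassJ.bijective_restrictDegree_phiEETL (hS : IsClassJ p S) :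
    Function.Bijective ((phiEETL p lam S).toLinearMap ∘ₗ
      (restrictDegree (EETL p lam S) ℤ_[p] (p - 1)).subtype) := by
  have := hS.wellOrdered
  refine bijective_restrictDegree_of_equiv (Equiv.ofBijective _ hS.bijective_eetlElem) ?_
  exact bijective_restrictDegree (fun n hn => isUnit_natCast_of_not_dvd hn)
    hS.hasUnitLead_eetlElem

theorem IsClassJ.phiEETL_surjective (hS : IsClassJ p S) :
    Function.Surjective (phiEETL p lam S) := fun x => by
  obtain ⟨⟨f, _⟩, h⟩ := hS.bijective_restrictDegree_phiEETL (lam := lam) |>.2 x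
  exact ⟨f, h⟩

theorem dvd_phiEETL_rel₁ (hlam : IsUnit lam) (v : TL₁ p S) :
    (p : Sh lam S) ∣ phiEETL p lam S (rel₁ p lam v) := by
  obtain ⟨_, w, hw, i, rfl⟩ := v
  set v := tensorPow w (p ^ i) with hv
  have hfix : letterPow p v = v := by
    rw [hv, letterPow_tensorPow, hw.2]
  have h1 := dvd_word_pow_sub (p := p) (dvd_pow_sub_one hlam) v
  have h2 : (p : ℤ_[p]) ∣ lam ^ ((v.length - 1) * (p - 1)) - 1 := by
    rw [mul_comm, pow_mul]
    exact (dvd_pow_sub_one hlam).trans (by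
      simpa using sub_dvd_pow_sub_pow (lam ^ (p - 1)) 1 (v.length - 1))
  have h3 := dvd_sub h1 (natCast_dvd_smul h2 (word lam v))
  rw [hfix, sub_smul, one_smul, sub_sub_sub_cancel_right] at h3
  have h4 : phiEETL p lam S (rel₁ p lam ⟨v, w, hw, i, rfl⟩) =
      word lam v ^ p - lam ^ ((v.length - 1) * (p - 1)) • word lam v := by
    simp [rel₁, var₁, phiEETL, Algebra.smul_def]
  rw [h4]
  exact h3

theorem IsClassJ.dvd_phiEETL_rel₂ (hS : IsClassJ p S) (hlam : IsUnit lam) (x : EETL₂ p lam S) :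
    (p : Sh lam S) ∣ phiEETL p lam S (rel₂ p lam x) := by
  obtain ⟨_, v, hv, rfl⟩ := x
  have h0 := dvd_pow_sub_one hlam
  have h1 := dvd_word_pow_sub (p := p) h0 v
  have h2 := dvd_word_pow_sub (p := p) h0 (letterPow p v)
  rw [hS.letterPow_letterPow] at h2
  -- Expanding `((w - w^(p)) + w^(p)) ^ p` instead of `(w - w^(p)) ^ p` avoids the sign at `p = 2`.
  obtain ⟨r, hr⟩ := exists_add_pow_prime_eq (Fact.out (p := p.Prime))
    (word lam v - word lam (letterPow p v)) (word lam (letterPow p v))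
  rw [sub_add_cancel] at hr
  have h4 : phiEETL p lam S (rel₂ p lam ⟨_, v, hv, rfl⟩) =
      (word lam v - word lam (letterPow p v)) ^ p := by
    simp [rel₂, var₂, phiEETL]
  rw [h4]
  have h5 := dvd_sub (dvd_sub h1 h2) (dvd_mul_right (p : Sh lam S)
    ((word lam v - word lam (letterPow p v)) * word lam (letterPow p v) * r))
  convert h5 using 1
  linear_combination -hr

theorem IsClassJ.exists_isLift (hS : IsClassJ p S) (hlam : IsUnit lam) :
    ∃ Q₁ Q₂, IsLift (p := p) (lam := lam) (S := S) Q₁ Q₂ := by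
  choose a ha using dvd_phiEETL_rel₁ (p := p) (S := S) hlam
  choose b hb using hS.dvd_phiEETL_rel₂ hlam
  choose g hg using hS.phiEETL_surjective (lam := lam)
  exact ⟨fun v => g (a v), fun x => g (b x), fun v => by rw [ha, hg], fun x => by rw [hb, hg]⟩

theorem IsLift.map_eq_zero {Q₁ : TL₁ p S → MvPolynomial (EETL p lam S) ℤ_[p]}
    {Q₂ : EETL₂ p lam S → MvPolynomial (EETL p lam S) ℤ_[p]} (hQ : IsLift Q₁ Q₂)
    {f : MvPolynomial (EETL p lam S) ℤ_[p]} (hf : f ∈ relIdeal Q₁ Q₂) :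
    phiEETL p lam S f = 0 := by
  have h : relIdeal Q₁ Q₂ ≤ RingHom.ker (phiEETL p lam S) := by
    refine Ideal.span_le.2 ?_
    rintro _ (⟨v, rfl⟩ | ⟨x, rfl⟩)
    · simp only [SetLike.mem_coe, RingHom.mem_ker, map_sub, map_mul, map_natCast, hQ.1, sub_self]
    · simp only [SetLike.mem_coe, RingHom.mem_ker, map_sub, map_mul, map_natCast, hQ.2, sub_self]
  exact h hf

theorem exists_relIdeal_rel (Q₁ : TL₁ p S → MvPolynomial (EETL p lam S) ℤ_[p])
    (Q₂ : EETL₂ p lam S → MvPolynomial (EETL p lam S) ℤ_[p]) (y : EETL p lam S) :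
    ∃ c : ℤ_[p], X y ^ p - C c * X y ∈ relIdeal Q₁ Q₂ ⊔
      Ideal.span {(p : MvPolynomial (EETL p lam S) ℤ_[p])} := by
  have key : ∀ {f q}, f - (p : MvPolynomial (EETL p lam S) ℤ_[p]) * q ∈ relIdeal Q₁ Q₂ →
      f ∈ relIdeal Q₁ Q₂ ⊔ Ideal.span {(p : MvPolynomial (EETL p lam S) ℤ_[p])} := by
    intro f q h
    have := Submodule.add_mem_sup h (Ideal.mem_span_singleton.2 (dvd_mul_right
      (p : MvPolynomial (EETL p lam S) ℤ_[p]) q))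
    rwa [sub_add_cancel] at this
  obtain ⟨y, ⟨v, hv, rfl⟩ | hy⟩ := y
  · exact ⟨_, key (Ideal.subset_span (Or.inl ⟨⟨v, hv⟩, rfl⟩))⟩
  · refine ⟨0, ?_⟩
    rw [map_zero, zero_mul, sub_zero]
    exact key (Ideal.subset_span (Or.inr ⟨⟨y, hy⟩, rfl⟩))

theorem IsClassJ.exists_bijective_liftₐ (hS : IsClassJ p S)
    {Q₁ : TL₁ p S → MvPolynomial (EETL p lam S) ℤ_[p]}
    {Q₂ : EETL₂ p lam S → MvPolynomial (EETL p lam S) ℤ_[p]} (hQ : IsLift Q₁ Q₂) :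
    ∃ h : ∀ a ∈ padicClosure p (relIdeal Q₁ Q₂), phiEETL p lam S a = 0,
      Function.Bijective (Ideal.Quotient.liftₐ (padicClosure p (relIdeal Q₁ Q₂))
        (phiEETL p lam S) h) := by
  refine ⟨fun a ha => map_eq_zero_of_mem_padicClosure
    (fun _ => Sh_eq_zero_of_forall_pow_dvd) (fun f hf => hQ.map_eq_zero hf) ha, ?_, ?_⟩
  · refine (injective_iff_map_eq_zero _).2 fun a => ?_
    obtain ⟨a, rfl⟩ := Ideal.Quotient.mk_surjective a
    intro ha
    choose c hc using exists_relIdeal_rel Q₁ Q₂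
    exact Ideal.Quotient.eq_zero_iff_mem.2 (mem_padicClosure_of_map_eq_zero
      hS.bijective_restrictDegree_phiEETL (fun f hf => hQ.map_eq_zero hf) c hc ha)
  · intro x
    obtain ⟨f, rfl⟩ := hS.phiEETL_surjective x
    exact ⟨Ideal.Quotient.mk _ f, rfl⟩

end ClassJ

/-! ### The grading over the free abelian semigroup -/

section FreeWords

variable {X : Type*}

namespace FreeAbSemigroup

theorem deg_mul (f g : FreeAbSemigroup X) : (f * g).deg = f.deg + g.deg :=
  map_add Finsupp.degree f.1 g.1

theorem deg_pos (f : FreeAbSemigroup X) : 0 < f.deg :=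
  Nat.pos_of_ne_zero fun h => f.2 ((Finsupp.degree_eq_zero_iff _).1 h)

theorem val_sgPow (f : FreeAbSemigroup X) {n : ℕ} (hn : n ≠ 0) : (sgPow f n).1 = n • f.1 := by
  obtain ⟨n, rfl⟩ := Nat.exists_eq_succ_of_ne_zero hn
  induction n with
  | zero => simp [sgPow_one]
  | succ n ih =>
    rw [Nat.succ_eq_add_one, ← mul_sgPow f (Nat.succ_ne_zero n), succ_nsmul' f.1 (n + 1),
      ← ih (Nat.succ_ne_zero n)]
    rfl

theorem deg_sgPow (f : FreeAbSemigroup X) {n : ℕ} (hn : n ≠ 0) :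
    (sgPow f n).deg = n * f.deg := by
  rw [deg, val_sgPow f hn, map_nsmul, smul_eq_mul]
  rfl

variable [LinearOrder X]

theorem lt_iff (f g : FreeAbSemigroup X) : f < g ↔ toDegLex f.1 < toDegLex g.1 := Iff.rfl

theorem sgPow_strictMono {n : ℕ} (hn : n ≠ 0) :
    StrictMono fun f : FreeAbSemigroup X => sgPow f n := by
  intro f g h
  rw [lt_iff] at *
  rw [val_sgPow f hn, val_sgPow g hn]
  exact nsmul_right_strictMono hn h

instance [Finite X] : WellFoundedLT (FreeAbSemigroup X) :=
  ⟨InvImage.wf (fun f : FreeAbSemigroup X => toDegLex f.1) wellFounded_lt⟩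

end FreeAbSemigroup

theorem wordDeg_nil : wordDeg ([] : List (FreeAbSemigroup X)) = 0 := rfl

theorem wordDeg_cons (a : FreeAbSemigroup X) (w : List (FreeAbSemigroup X)) :
    wordDeg (a :: w) = a.deg + wordDeg w := by
  simp [wordDeg]

theorem wordDeg_append (u v : List (FreeAbSemigroup X)) :
    wordDeg (u ++ v) = wordDeg u + wordDeg v := by
  simp [wordDeg]

theorem wordDeg_pos {w : List (FreeAbSemigroup X)} (hw : w ≠ []) : 0 < wordDeg w := by
  cases w with
  | nil => exact absurd rfl hw
  | cons a w =>
    rw [wordDeg_cons]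
    have := a.deg_pos
    omega

theorem wordDeg_tensorPow (w : List (FreeAbSemigroup X)) (n : ℕ) :
    wordDeg (tensorPow w n) = n * wordDeg w := by
  induction n with
  | zero => simp [tensorPow_zero, wordDeg_nil]
  | succ n ih => rw [tensorPow_succ, wordDeg_append, ih]; ring

theorem wordDeg_letterPow {n : ℕ} (hn : n ≠ 0) (w : List (FreeAbSemigroup X)) :
    wordDeg (letterPow n w) = n * wordDeg w := by
  induction w with
  | nil => rfl
  | cons a w ih => rw [letterPow_cons, wordDeg_cons, wordDeg_cons, ih, a.deg_sgPow hn]; ring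

theorem finite_setOf_wordDeg_le [Finite X] (n : ℕ) :
    {w : List (FreeAbSemigroup X) | wordDeg w ≤ n}.Finite := by
  have hA : ∀ n, {a : FreeAbSemigroup X | a.deg ≤ n}.Finite := fun n =>
    (Finsupp.finite_of_degree_le n).preimage Subtype.val_injective.injOn
  induction n with
  | zero =>
    refine (Set.finite_singleton []).subset fun w hw => ?_
    by_contra h
    exact absurd (wordDeg_pos h) (not_lt.2 hw)
  | succ n ih =>
    refine ((Set.finite_singleton []).union (Set.Finite.image2 List.cons (hA (n + 1)) ih)).subset
      fun w hw => ?_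
    cases w with
    | nil => exact Or.inl rfl
    | cons a w =>
      refine Or.inr ⟨a, ?_, w, ?_, rfl⟩
      · have : wordDeg (a :: w) ≤ n + 1 := hw
        rw [wordDeg_cons] at this
        exact le_trans (Nat.le_add_right _ _) this
      · have : wordDeg (a :: w) ≤ n + 1 := hw
        rw [wordDeg_cons] at this
        have h1 := a.deg_pos
        change wordDeg w ≤ n
        omega

theorem finite_setOf_wordDeg_eq [Finite X] (n : ℕ) :
    {w : List (FreeAbSemigroup X) | wordDeg w = n}.Finite :=
  (finite_setOf_wordDeg_le n).subset fun _ h => le_of_eq h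

variable [LinearOrder X]

theorem letterPow_lt_letterPow {n : ℕ} (hn : n ≠ 0) {u v : List (FreeAbSemigroup X)}
    (h : u < v) : letterPow n u < letterPow n v := by
  induction u generalizing v with
  | nil =>
    cases v with
    | nil => exact absurd h (lt_irrefl _)
    | cons b v => exact List.nil_lt_cons _ _
  | cons a u ih =>
    cases v with
    | nil => exact absurd h (List.not_lt_nil _)
    | cons b v =>
      rw [letterPow_cons, letterPow_cons]
      rcases List.cons_lt_cons_iff.1 h with h' | ⟨rfl, h'⟩
      · exact List.cons_lt_cons_iff.2 (Or.inl (FreeAbSemigroup.sgPow_strictMono hn h'))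
      · exact cons_lt_cons_of_lt _ (ih h')

theorem letterPow_strictMono {n : ℕ} (hn : n ≠ 0) :
    StrictMono (letterPow n : List (FreeAbSemigroup X) → List (FreeAbSemigroup X)) :=
  fun _ _ h => letterPow_lt_letterPow hn h

theorem letterPow_mem_Lyn_iff {n : ℕ} (hn : n ≠ 0) {w : List (FreeAbSemigroup X)} :
    letterPow n w ∈ Lyn (FreeAbSemigroup X) ↔ w ∈ Lyn (FreeAbSemigroup X) := by
  constructor
  · rintro ⟨h1, h2⟩
    refine ⟨fun h => h1 (by rw [h]; rfl), fun u v hu hv huv => ?_⟩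
    have := h2 (letterPow n u) (letterPow n v) (by simpa [letterPow] using hu)
      (by simpa [letterPow] using hv) (by rw [huv, letterPow_append])
    exact (letterPow_strictMono hn).lt_iff_lt.1 this
  · rintro ⟨h1, h2⟩
    refine ⟨by simpa [letterPow] using h1, fun u v hu hv huv => ?_⟩
    obtain ⟨u', v', rfl, rfl, rfl⟩ := List.map_eq_append_iff.1 huv
    exact letterPow_lt_letterPow hn (h2 u' v' (by simpa using hu) (by simpa using hv) rfl)

variable {p : ℕ} [Fact p.Prime]

/-- In the free abelian semigroup, every Lyndon word is obtained from a word in `E(Lyn)` by raising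
the letters to a `p`-power. -/
theorem exists_letterPow_eq {l : List (FreeAbSemigroup X)} (hl : l ∈ Lyn (FreeAbSemigroup X)) :
    ∃ e ∈ opE p (Lyn (FreeAbSemigroup X)), ∃ j, letterPow (p ^ j) e = l := by
  have hp := (Fact.out (p := p.Prime))
  induction hn : wordDeg l using Nat.strong_induction_on generalizing l with
  | _ n ih =>
    by_cases hE : l ∈ opE p (Lyn (FreeAbSemigroup X))
    · exact ⟨l, hE, 0, by rw [pow_zero, letterPow_one]⟩
    · have : ∃ u, l = letterPow p u := by
        by_contra h
        push Not at h
        exact hE ⟨hl, Or.inr h⟩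
      obtain ⟨u, rfl⟩ := this
      have hu := (letterPow_mem_Lyn_iff hp.ne_zero).1 hl
      obtain ⟨e, he, j, rfl⟩ := ih (wordDeg u) (by
        rw [wordDeg_letterPow hp.ne_zero] at hn
        have := wordDeg_pos hu.1
        nlinarith [hp.two_le]) hu rfl
      exact ⟨e, he, j + 1, by
        rw [letterPow_letterPow (pow_ne_zero _ hp.ne_zero) hp.ne_zero, ← pow_succ]⟩

theorem not_eq_letterPow_of_mem_opE {e : List (FreeAbSemigroup X)}
    (he : e ∈ opE p (Lyn (FreeAbSemigroup X))) (u : List (FreeAbSemigroup X)) :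
    e ≠ letterPow p u := by
  have hp := (Fact.out (p := p.Prime))
  obtain ⟨h1, h2 | h2⟩ := he
  · have h3 := wordDeg_letterPow hp.ne_zero e
    rw [← h2] at h3
    have := wordDeg_pos h1.1
    nlinarith [hp.two_le]
  · exact h2 u

theorem letterPow_pow_injective {e e' : List (FreeAbSemigroup X)}
    (he : e ∈ opE p (Lyn (FreeAbSemigroup X))) (he' : e' ∈ opE p (Lyn (FreeAbSemigroup X)))
    {j j' : ℕ} (h : letterPow (p ^ j) e = letterPow (p ^ j') e') : e = e' ∧ j = j' := by
  have hp := (Fact.out (p := p.Prime)).ne_zero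
  have key : ∀ {e e' : List (FreeAbSemigroup X)} {i i' : ℕ},
      e ∈ opE p (Lyn (FreeAbSemigroup X)) →
      letterPow (p ^ i) e = letterPow (p ^ i') e' → i' ≤ i := by
    intro e e' i i' he h
    by_contra hlt
    obtain ⟨c, rfl⟩ : ∃ c, i' = (c + 1) + i := ⟨i' - i - 1, by omega⟩
    rw [pow_add, ← letterPow_letterPow (pow_ne_zero _ hp) (pow_ne_zero _ hp), pow_succ,
      ← letterPow_letterPow (pow_ne_zero _ hp) hp] at h
    exact not_eq_letterPow_of_mem_opE he _
      ((letterPow_strictMono (pow_ne_zero _ hp)).injective h)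
  have hj : j = j' := le_antisymm (key he' h.symm) (key he h)
  subst hj
  exact ⟨(letterPow_strictMono (pow_ne_zero _ hp)).injective h, rfl⟩

/-- The Lyndon words of degree `n` and the words of degree `n` in `TEL` are both parametrized by
the pairs `(e, i)` with `e` in `E(Lyn)` and `p ^ i * deg e = n`. -/
theorem ncard_TELDeg_eq (n : ℕ) : (TELDeg p X n).ncard = (LynDeg X n).ncard := by
  have hp := (Fact.out (p := p.Prime))
  set D : Set (opE p (Lyn (FreeAbSemigroup X)) × ℕ) := {q | p ^ q.2 * wordDeg q.1.1 = n} with hD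
  have h1 : TELDeg p X n = (fun q : opE p (Lyn (FreeAbSemigroup X)) × ℕ =>
      tensorPow q.1.1 (p ^ q.2)) '' D := by
    ext w
    constructor
    · rintro ⟨⟨e, he, i, rfl⟩, hw⟩
      exact ⟨(⟨e, he⟩, i), (wordDeg_tensorPow _ _).symm.trans hw, rfl⟩
    · rintro ⟨⟨⟨e, he⟩, i⟩, hw, rfl⟩
      exact ⟨⟨e, he, i, rfl⟩, (wordDeg_tensorPow _ _).trans hw⟩
  have h2 : LynDeg X n = (fun q : opE p (Lyn (FreeAbSemigroup X)) × ℕ =>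
      letterPow (p ^ q.2) q.1.1) '' D := by
    ext w
    constructor
    · rintro ⟨hl, hw⟩
      obtain ⟨e, he, j, rfl⟩ := exists_letterPow_eq (p := p) hl
      exact ⟨(⟨e, he⟩, j), (wordDeg_letterPow (pow_ne_zero _ hp.ne_zero) _).symm.trans hw, rfl⟩
    · rintro ⟨⟨⟨e, he⟩, i⟩, hw, rfl⟩
      exact ⟨(letterPow_mem_Lyn_iff (pow_ne_zero _ hp.ne_zero)).2 he.1,
        (wordDeg_letterPow (pow_ne_zero _ hp.ne_zero) _).trans hw⟩
  rw [h1, h2, Set.ncard_image_of_injective, Set.ncard_image_of_injective]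
  · rintro ⟨⟨e, he⟩, i⟩ ⟨⟨e', he'⟩, i'⟩ h
    obtain ⟨rfl, rfl⟩ := letterPow_pow_injective he he' h
    rfl
  · rintro ⟨⟨e, he⟩, i⟩ ⟨⟨e', he'⟩, i'⟩ h
    obtain ⟨rfl, h3⟩ := tensorPow_injective he.1 he'.1 (pow_ne_zero _ hp.ne_zero)
      (pow_ne_zero _ hp.ne_zero) h
    obtain rfl := Nat.pow_right_injective hp.two_le h3
    rfl

end FreeWords

section Grading

variable {k : Type*} [CommRing k] {lam : k} {X : Type*}

theorem degPart_eq_wordSpan (n : ℕ) : degPart lam X n = wordSpan lam {w | wordDeg w = n} := by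
  rw [wordSpan_eq_span, degPart]
  congr 1
  ext x
  constructor
  · rintro ⟨w, hw, rfl⟩
    exact ⟨w, hw, rfl⟩
  · rintro ⟨w, hw, rfl⟩
    exact ⟨w, hw, rfl⟩

theorem mem_degPart_iff {n : ℕ} {x : Sh lam (FreeAbSemigroup X)} :
    x ∈ degPart lam X n ↔ ∀ w, wordDeg w ≠ n → coeffWord lam w x = 0 := by
  rw [degPart_eq_wordSpan, mem_wordSpan_iff]
  rfl

theorem word_mem_degPart (w : List (FreeAbSemigroup X)) : word lam w ∈ degPart lam X (wordDeg w) :=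
  Submodule.subset_span ⟨w, rfl, rfl⟩

theorem consLin_mem_degPart (a : FreeAbSemigroup X) {n : ℕ} {x : Sh lam (FreeAbSemigroup X)}
    (hx : x ∈ degPart lam X n) : consLin lam a x ∈ degPart lam X (a.deg + n) := by
  have : degPart lam X n ≤ (degPart lam X (a.deg + n)).comap (consLin lam a) := by
    refine Submodule.span_le.2 ?_
    rintro _ ⟨w, rfl, rfl⟩
    change consLin lam a (word lam w) ∈ degPart lam X (a.deg + wordDeg w)
    rw [consLin_word, ← wordDeg_cons]
    exact word_mem_degPart _
  exact this hx

theorem word_mul_word_mem_degPart (u v : List (FreeAbSemigroup X)) :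
    word lam u * word lam v ∈ degPart lam X (wordDeg u + wordDeg v) := by
  match u, v with
  | [], v =>
    have : word lam ([] : List (FreeAbSemigroup X)) = 1 := rfl
    rw [this, one_mul, wordDeg_nil, zero_add]
    exact word_mem_degPart v
  | a :: u, [] =>
    have : word lam ([] : List (FreeAbSemigroup X)) = 1 := rfl
    rw [this, mul_one, wordDeg_nil, add_zero]
    exact word_mem_degPart _
  | a :: u, b :: v =>
    have h1 := consLin_mem_degPart a (word_mul_word_mem_degPart u (b :: v))
    have h2 := consLin_mem_degPart b (word_mul_word_mem_degPart (a :: u) v)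
    have h3 := consLin_mem_degPart (a * b) (word_mul_word_mem_degPart u v)
    rw [← consLin_word a, ← consLin_word b, consLin_mul_consLin, consLin_word, consLin_word]
    refine Submodule.add_mem _ (Submodule.add_mem _ ?_ ?_) (Submodule.smul_mem _ _ ?_)
    · convert h1 using 2
      rw [wordDeg_cons a]; ring
    · convert h2 using 2
      rw [wordDeg_cons b]; ring
    · convert h3 using 2
      rw [wordDeg_cons, wordDeg_cons, FreeAbSemigroup.deg_mul]; ring
termination_by u.length + v.length

theorem mul_mem_degPart {m n : ℕ} {x y : Sh lam (FreeAbSemigroup X)}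
    (hx : x ∈ degPart lam X m) (hy : y ∈ degPart lam X n) : x * y ∈ degPart lam X (m + n) := by
  rw [degPart_eq_wordSpan] at hx hy
  refine mul_mem_wordSpan_of_forall ?_ hx hy
  rintro u rfl v rfl
  exact word_mul_word_mem_degPart u v

theorem fg_degPart [Finite X] (n : ℕ) : (degPart lam X n).FG := by
  rw [degPart_eq_wordSpan, wordSpan_eq_span]
  exact Submodule.fg_span ((finite_setOf_wordDeg_eq n).image _)

instance gradedMonoid_degPart : SetLike.GradedMonoid (degPart lam X) where
  one_mem := word_mem_degPart []
  mul_mem _ _ _ _ hx hy := mul_mem_degPart hx hy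

theorem isInternal_degPart : DirectSum.IsInternal (degPart lam X) := by
  rw [DirectSum.isInternal_submodule_iff_iSupIndep_and_iSup_eq_top]
  constructor
  · intro n
    have h : ⨆ m, ⨆ (_ : m ≠ n), degPart lam X m ≤ wordSpan lam {w | wordDeg w ≠ n} := by
      refine iSup₂_le fun m hm => ?_
      rw [degPart_eq_wordSpan]
      refine wordSpan_mono fun w hw => ?_
      change wordDeg w = m at hw
      change wordDeg w ≠ n
      omega
    refine Disjoint.mono_right h (Submodule.disjoint_def.2 fun x hx hx' => Sh_ext fun w => ?_)
    rw [map_zero]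
    by_cases hw : wordDeg w = n
    · exact mem_wordSpan_iff.1 hx' w fun h => h hw
    · exact mem_degPart_iff.1 hx w hw
  · rw [eq_top_iff, ← span_word_eq_top, Submodule.span_le]
    rintro _ ⟨w, rfl⟩
    exact Submodule.mem_iSup_of_mem (wordDeg w) (word_mem_degPart w)

theorem decomposables_le (n : ℕ) : decomposables lam X n ≤ degPart lam X n := by
  refine iSup₂_le fun i hi => Submodule.mul_le.2 fun x hx y hy => ?_
  rw [Finset.mem_Ico] at hi
  have := mul_mem_degPart hx hy
  rwa [Nat.add_sub_cancel' hi.2.le] at this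

end Grading

/-! ### The isomorphism `ℤ_[p][TEL] ≃ Sh(S)` -/

section Graded

variable {k A Y : Type*} [CommRing k] [CommRing A] [Algebra k A] (𝒜 : ℕ → Submodule k A)
  [SetLike.GradedMonoid 𝒜] {y : Y → A} {wt : Y → ℕ}

theorem prod_mem_of_forall_mem (hy : ∀ i, y i ∈ 𝒜 (wt i)) (μ : Y →₀ ℕ) :
    (μ.prod fun i n => y i ^ n) ∈ 𝒜 (Finsupp.weight wt μ) := by
  rw [Finsupp.weight_apply]
  exact SetLike.prod_pow_mem_graded 𝒜 wt y μ fun i _ => hy i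

theorem aeval_monomial_mem_of_forall_mem (hy : ∀ i, y i ∈ 𝒜 (wt i)) (μ : Y →₀ ℕ) (c : k) :
    aeval y (monomial μ c) ∈ 𝒜 (Finsupp.weight wt μ) := by
  rw [aeval_monomial, ← Algebra.smul_def]
  exact Submodule.smul_mem _ _ (prod_mem_of_forall_mem 𝒜 hy μ)

theorem aeval_mem_of_isWeightedHomogeneous (hy : ∀ i, y i ∈ 𝒜 (wt i)) {n : ℕ}
    {f : MvPolynomial Y k} (hf : f.IsWeightedHomogeneous wt n) : aeval y f ∈ 𝒜 n := by
  rw [f.as_sum, map_sum]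
  refine Submodule.sum_mem _ fun μ hμ => ?_
  rw [← hf (mem_support_iff.1 hμ)]
  exact aeval_monomial_mem_of_forall_mem 𝒜 hy μ _

end Graded

section Surjective

variable {k Y X : Type*} [CommRing k] {lam : k} {y : Y → Sh lam (FreeAbSemigroup X)} {wt : Y → ℕ}

/-- A surjection from a polynomial ring that maps variables to homogeneous elements is surjective
in every degree. -/
theorem exists_isWeightedHomogeneous_of_mem_degPart (hy : ∀ i, y i ∈ degPart lam X (wt i))
    {f : MvPolynomial Y k} {n : ℕ} (hf : aeval y f ∈ degPart lam X n) :
    ∃ g : MvPolynomial Y k, g.IsWeightedHomogeneous wt n ∧ aeval y g = aeval y f := by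
  refine ⟨weightedHomogeneousComponent wt n f,
    weightedHomogeneousComponent_isWeightedHomogeneous n f, Sh_ext fun w => ?_⟩
  have h1 := aeval_mem_of_isWeightedHomogeneous (degPart lam X) hy
    (weightedHomogeneousComponent_isWeightedHomogeneous (w := wt) n f)
  by_cases hw : wordDeg w = n
  · have h2 : coeffWord lam w ∘ₗ (aeval y).toLinearMap ∘ₗ weightedHomogeneousComponent wt n =
        coeffWord lam w ∘ₗ (aeval (R := k) y).toLinearMap := by
      refine MvPolynomial.linearMap_ext fun μ => LinearMap.ext_ring ?_
      change coeffWord lam w (aeval y (weightedHomogeneousComponent wt n (monomial μ 1))) =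
        coeffWord lam w (aeval y (monomial μ 1))
      have hμ : monomial μ (1 : k) ∈ weightedHomogeneousSubmodule k wt (Finsupp.weight wt μ) :=
        isWeightedHomogeneous_monomial _ _ _ rfl
      rw [weightedHomogeneousComponent_of_mem hμ]
      split_ifs with h
      · rfl
      · rw [map_zero, map_zero]
        refine (mem_degPart_iff.1
          (aeval_monomial_mem_of_forall_mem (degPart lam X) hy μ 1) w ?_).symm
        rw [hw]
        exact h
    exact LinearMap.congr_fun h2 f
  · rw [mem_degPart_iff.1 h1 w hw, mem_degPart_iff.1 hf w hw]

end Surjective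

section TELIso

variable {p : ℕ} [Fact p.Prime] {lam : ℤ_[p]} {X : Type*} [LinearOrder X]

theorem dvd_word_pow_pow_sub (hlam : IsUnit lam) {S : Type*} [CommSemigroup S] (w : List S)
    (j : ℕ) : (p : Sh lam S) ∣ word lam w ^ p ^ j - word lam (letterPow (p ^ j) w) := by
  have hp := (Fact.out (p := p.Prime)).ne_zero
  induction j with
  | zero => simp [letterPow_one]
  | succ j ih =>
    have h1 := dvd_word_pow_sub (p := p) (dvd_pow_sub_one hlam) (letterPow (p ^ j) w)
    rw [letterPow_letterPow (pow_ne_zero _ hp) hp, ← pow_succ] at h1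
    have h2 := ih.trans (sub_dvd_pow_sub_pow _ _ p)
    rw [← pow_mul, ← pow_succ] at h2
    have := dvd_add h2 h1
    rwa [sub_add_sub_cancel] at this

/-- The word in `TEL` and the exponent `j` such that raising the letters of the former to the
`p ^ j`-th power gives the word `l ^ (p ^ i)`. -/
def telRoot (q : Lyn (FreeAbSemigroup X) × ℕ) : TEL p (FreeAbSemigroup X) × ℕ :=
  (⟨tensorPow (exists_letterPow_eq (p := p) q.1.2).choose (p ^ q.2), _,
    (exists_letterPow_eq (p := p) q.1.2).choose_spec.1, q.2, rfl⟩,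
    (exists_letterPow_eq (p := p) q.1.2).choose_spec.2.choose)

theorem letterPow_telRoot (q : Lyn (FreeAbSemigroup X) × ℕ) :
    letterPow (p ^ (telRoot (p := p) q).2) (telRoot (p := p) q).1.1 =
      tensorPow q.1.1 (p ^ q.2) := by
  have h := (exists_letterPow_eq (p := p) q.1.2).choose_spec.2.choose_spec
  rw [telRoot, letterPow_tensorPow, h]

theorem bijective_telRoot : Function.Bijective
    (telRoot (p := p) : Lyn (FreeAbSemigroup X) × ℕ → TEL p (FreeAbSemigroup X) × ℕ) := by
  have hp := (Fact.out (p := p.Prime))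
  constructor
  · rintro q q' h
    have h1 := letterPow_telRoot (p := p) q
    rw [h, letterPow_telRoot] at h1
    obtain ⟨h2, h3⟩ := tensorPow_injective q'.1.2 q.1.2 (pow_ne_zero _ hp.ne_zero)
      (pow_ne_zero _ hp.ne_zero) h1
    exact Prod.ext (Subtype.ext h2.symm) (Nat.pow_right_injective hp.two_le h3).symm
  · rintro ⟨⟨t, e, he, i, rfl⟩, j⟩
    have hl : letterPow (p ^ j) e ∈ Lyn (FreeAbSemigroup X) :=
      (letterPow_mem_Lyn_iff (pow_ne_zero _ hp.ne_zero)).2 he.1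
    have hspec := (exists_letterPow_eq (p := p) hl).choose_spec
    obtain ⟨h1, h2⟩ := letterPow_pow_injective hspec.1 he hspec.2.choose_spec
    refine ⟨(⟨_, hl⟩, i), Prod.ext (Subtype.ext ?_) h2⟩
    exact congrArg (fun u => tensorPow u (p ^ i)) h1

/-- The element `w^(p^j)` attached to `w` in `TEL` and `j`; it is congruent to the `p ^ j`-th power
of `w` modulo `p`. -/
def telElem (lam : ℤ_[p]) (q : TEL p (FreeAbSemigroup X) × ℕ) : Sh lam (FreeAbSemigroup X) :=
  word lam (letterPow (p ^ q.2) q.1.1)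

theorem bijective_restrictDegree_telElem [Finite X] : Function.Bijective
    ((aeval (R := ℤ_[p]) (telElem (X := X) lam)).toLinearMap ∘ₗ
      (restrictDegree (TEL p (FreeAbSemigroup X) × ℕ) ℤ_[p] (p - 1)).subtype) := by
  refine bijective_restrictDegree_of_equiv (Equiv.ofBijective _ bijective_telRoot) ?_
  refine bijective_restrictDegree (fun n hn => isUnit_natCast_of_not_dvd hn) fun q => ?_
  change HasUnitLead (telElem lam (telRoot q)) _
  rw [telElem, letterPow_telRoot]
  exact hasUnitLead_word _

variable (p X) in
/-- The homomorphism that maps the variable of `(w, j)` to the `p ^ j`-th power of the variable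
of `w`. -/
def powHom : MvPolynomial (TEL p (FreeAbSemigroup X) × ℕ) ℤ_[p] →ₐ[ℤ_[p]]
    MvPolynomial (TEL p (FreeAbSemigroup X)) ℤ_[p] :=
  aeval fun q => MvPolynomial.X q.1 ^ p ^ q.2

theorem isWeightedHomogeneous_powHom {n : ℕ}
    {g : MvPolynomial (TEL p (FreeAbSemigroup X) × ℕ) ℤ_[p]}
    (hg : g.IsWeightedHomogeneous (fun q => p ^ q.2 * wordDeg q.1.1) n) :
    (powHom p X g).IsWeightedHomogeneous (fun w => wordDeg w.1) n := by
  have := WeightedHomogeneousSubmodule.gradedMonoid (R := ℤ_[p])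
    (w := fun w : TEL p (FreeAbSemigroup X) => wordDeg w.1)
  exact aeval_mem_of_isWeightedHomogeneous
    (weightedHomogeneousSubmodule ℤ_[p] fun w : TEL p (FreeAbSemigroup X) => wordDeg w.1)
    (y := fun q : TEL p (FreeAbSemigroup X) × ℕ => MvPolynomial.X q.1 ^ p ^ q.2)
    (wt := fun q : TEL p (FreeAbSemigroup X) × ℕ => p ^ q.2 * wordDeg q.1.1)
    (fun q => (isWeightedHomogeneous_X ℤ_[p] (fun w : TEL p (FreeAbSemigroup X) => wordDeg w.1)
      q.1).pow _) hg

theorem dvd_phiTEL_powHom_sub (hlam : IsUnit lam)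
    (f : MvPolynomial (TEL p (FreeAbSemigroup X) × ℕ) ℤ_[p]) :
    (p : Sh lam (FreeAbSemigroup X)) ∣
      phiTEL p lam X (powHom p X f) - aeval (telElem lam) f := by
  induction f using MvPolynomial.induction_on with
  | C a => simp [← algebraMap_eq]
  | add f g hf hg =>
    rw [map_add, map_add, map_add, add_sub_add_comm]
    exact dvd_add hf hg
  | mul_X f q hf =>
    have h : phiTEL p lam X (powHom p X (MvPolynomial.X q)) = word lam q.1.1 ^ p ^ q.2 := by
      simp [phiTEL, powHom]
    rw [map_mul, map_mul, map_mul, aeval_X, h]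
    have h1 := dvd_mul_of_dvd_left hf (word lam q.1.1 ^ p ^ q.2)
    have h2 := dvd_mul_of_dvd_right (dvd_word_pow_pow_sub hlam q.1.1 q.2)
      (aeval (telElem lam) f)
    convert dvd_add h1 h2 using 1
    rw [telElem]
    ring

/-- Writing the exponents in base `p`, every polynomial is the image under `powHom` of one with all
exponents less than `p`. -/
theorem exists_restrictDegree_powHom_eq (g : MvPolynomial (TEL p (FreeAbSemigroup X)) ℤ_[p]) :
    ∃ f ∈ restrictDegree (TEL p (FreeAbSemigroup X) × ℕ) ℤ_[p] (p - 1), powHom p X f = g := by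
  suffices h : (restrictDegree (TEL p (FreeAbSemigroup X) × ℕ) ℤ_[p] (p - 1)).map
      (powHom p X).toLinearMap = ⊤ by
    have : g ∈ (restrictDegree (TEL p (FreeAbSemigroup X) × ℕ) ℤ_[p] (p - 1)).map
      (powHom p X).toLinearMap := h ▸ Submodule.mem_top
    exact this
  refine eq_top_iff.2 fun g _ => ?_
  rw [g.as_sum]
  refine Submodule.sum_mem _ fun ν _ => ?_
  have h0 : digitsOf p 0 = 0 := by
    ext j
    change 0 / p ^ j % p = 0
    simp
  refine ⟨monomial (ν.mapRange (digitsOf p) h0).uncurry (g.coeff ν), ?_, ?_⟩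
  · rw [SetLike.mem_coe, mem_restrictDegree]
    intro s hs q
    rw [Finset.mem_singleton.1 (support_monomial_subset hs), Finsupp.uncurry_apply]
    exact Nat.le_sub_one_of_lt (digitsOf_lt _ _)
  · change powHom p X (monomial _ _) = _
    rw [powHom, aeval_monomial, monomial_eq, algebraMap_eq]
    congr 1
    have h1 : ∀ q : TEL p (FreeAbSemigroup X) × ℕ, ∀ n : ℕ,
        ((MvPolynomial.X q.1 : MvPolynomial (TEL p (FreeAbSemigroup X)) ℤ_[p]) ^ p ^ q.2) ^ n =
        MvPolynomial.X q.1 ^ (n * p ^ q.2) := fun q n => by rw [← pow_mul, mul_comm]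
    simp only [h1]
    have h2 := Finsupp.sum_uncurry_index' (N := Additive
      (MvPolynomial (TEL p (FreeAbSemigroup X)) ℤ_[p])) (ν.mapRange (digitsOf p) h0)
      (fun t j n => Additive.ofMul (MvPolynomial.X t ^ (n * p ^ j)))
    refine (congrArg Additive.toMul h2).trans ?_
    change (ν.mapRange (digitsOf p) h0).prod (fun t d =>
      d.prod fun j n => (MvPolynomial.X t) ^ (n * p ^ j)) = _
    rw [Finsupp.prod_mapRange_index (by simp)]
    refine Finsupp.prod_congr fun t _ => ?_
    rw [Finsupp.prod, Finset.prod_pow_eq_pow_sum]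
    congr 1
    exact evalDigits_digitsOf _

theorem phiTEL_X (t : TEL p (FreeAbSemigroup X)) :
    phiTEL p lam X (MvPolynomial.X t) = word lam t.1 := aeval_X _ _

theorem natCast_mul_Sh_eq_zero {S : Type*} [CommSemigroup S] {x : Sh lam S}
    (h : (p : Sh lam S) * x = 0) : x = 0 := by
  refine Sh_ext fun w => ?_
  have h1 := congrArg (coeffWord lam w) h
  rw [coeffWord_natCast_mul, map_zero, mul_eq_zero] at h1
  rw [map_zero]
  exact h1.resolve_left (Nat.cast_ne_zero.2 (Fact.out (p := p.Prime)).ne_zero)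

/-- A polynomial whose image is divisible by `p` is divisible by `p`; as both sides are `p`-adically
separated and torsion-free, this gives injectivity. -/
theorem phiTEL_injective [Finite X] (hlam : IsUnit lam) :
    Function.Injective (phiTEL p lam X) := by
  refine (injective_iff_map_eq_zero _).2 fun g hg => ?_
  have step : ∀ g, phiTEL p lam X g = 0 →
      ∃ g', phiTEL p lam X g' = 0 ∧ g = (p : MvPolynomial _ ℤ_[p]) * g' := by
    intro g hg
    obtain ⟨f, hf, rfl⟩ := exists_restrictDegree_powHom_eq g
    have h1 := dvd_phiTEL_powHom_sub hlam f
    rw [hg, zero_sub, dvd_neg] at h1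
    obtain ⟨s, hs⟩ := h1
    obtain ⟨⟨f', hf'⟩, rfl⟩ := bijective_restrictDegree_telElem.2 s
    have h2 : f = p • f' := by
      have := bijective_restrictDegree_telElem (lam := lam).1 (a₁ := ⟨f, hf⟩)
        (a₂ := ⟨p • f', nsmul_mem hf' p⟩) (by
          change aeval (telElem lam) f = aeval (telElem lam) (p • f')
          rw [hs, map_nsmul, nsmul_eq_mul]
          rfl)
      exact congrArg Subtype.val this
    refine ⟨powHom p X f', ?_, by rw [h2, map_nsmul, nsmul_eq_mul]⟩
    refine natCast_mul_Sh_eq_zero ?_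
    rw [h2, map_nsmul, map_nsmul, nsmul_eq_mul] at hg
    exact hg
  have hpow : ∀ n : ℕ, ∃ g', phiTEL p lam X g' = 0 ∧ g = (p : MvPolynomial _ ℤ_[p]) ^ n * g' := by
    intro n
    induction n with
    | zero => exact ⟨g, hg, by simp⟩
    | succ n ih =>
      obtain ⟨g', h1, h2⟩ := ih
      obtain ⟨g'', h3, rfl⟩ := step g' h1
      exact ⟨g'', h3, by rw [h2]; ring⟩
  ext μ
  rw [coeff_zero]
  refine eq_zero_of_forall_pow_dvd fun n => ?_
  obtain ⟨g', -, rfl⟩ := hpow n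
  rw [show (p : MvPolynomial (TEL p (FreeAbSemigroup X)) ℤ_[p]) ^ n = C ((p : ℤ_[p]) ^ n) by simp,
    coeff_C_mul]
  exact dvd_mul_right _ _

theorem phiTEL_mem_degPart {n : ℕ} {f : MvPolynomial (TEL p (FreeAbSemigroup X)) ℤ_[p]}
    (hf : f.IsWeightedHomogeneous (fun w => wordDeg w.1) n) :
    phiTEL p lam X f ∈ degPart lam X n :=
  aeval_mem_of_isWeightedHomogeneous (degPart lam X)
    (y := fun w : TEL p (FreeAbSemigroup X) => word lam w.1)
    (wt := fun w : TEL p (FreeAbSemigroup X) => wordDeg w.1)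
    (fun w => word_mem_degPart w.1) hf

/-- Surjectivity in every degree: it holds modulo `p`, hence holds by Nakayama's lemma. -/
theorem map_weightedHomogeneousSubmodule_eq [Finite X] (hlam : IsUnit lam) (n : ℕ) :
    (weightedHomogeneousSubmodule ℤ_[p] (fun w : TEL p (FreeAbSemigroup X) => wordDeg w.1) n).map
      (phiTEL p lam X).toLinearMap = degPart lam X n := by
  have hp := (Fact.out (p := p.Prime))
  refine le_antisymm ?_ ?_
  · rintro _ ⟨f, hf, rfl⟩
    exact phiTEL_mem_degPart hf
  · refine Submodule.le_of_le_smul_of_le_jacobson_bot (I := Ideal.span {(p : ℤ_[p])})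
      (fg_degPart n) ?_ ?_
    · rw [← PadicInt.maximalIdeal_eq_span_p, IsLocalRing.jacobson_eq_maximalIdeal _ bot_ne_top]
    · intro x hx
      obtain ⟨⟨f, _⟩, rfl⟩ := bijective_restrictDegree_telElem.2 x
      obtain ⟨g, hg, hgf⟩ := exists_isWeightedHomogeneous_of_mem_degPart
        (y := telElem (X := X) lam) (wt := fun q => p ^ q.2 * wordDeg q.1.1) (fun q => by
          have := word_mem_degPart (lam := lam) (letterPow (p ^ q.2) q.1.1)
          rwa [wordDeg_letterPow (pow_ne_zero _ hp.ne_zero)] at this) hx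
      change aeval (telElem lam) f ∈ _
      change aeval (telElem lam) f ∈ _ at hx
      change aeval (telElem lam) g = aeval (telElem lam) f at hgf
      have h1 := isWeightedHomogeneous_powHom hg
      have h2 := phiTEL_mem_degPart (lam := lam) h1
      obtain ⟨s, hs⟩ := dvd_phiTEL_powHom_sub hlam g
      have h3 : s ∈ degPart lam X n := by
        rw [mem_degPart_iff]
        intro w hw
        have h4 := mem_degPart_iff.1 (Submodule.sub_mem _ h2 (hgf ▸ hx)) w hw
        rw [hs, coeffWord_natCast_mul, mul_eq_zero] at h4
        exact h4.resolve_left (Nat.cast_ne_zero.2 hp.ne_zero)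
      rw [← hgf, ← sub_sub_cancel (phiTEL p lam X (powHom p X g)) (aeval (telElem lam) g), hs]
      refine Submodule.sub_mem _ (Submodule.mem_sup_left ⟨_, h1, rfl⟩) (Submodule.mem_sup_right ?_)
      rw [← nsmul_eq_mul, ← Nat.cast_smul_eq_nsmul ℤ_[p]]
      exact Submodule.smul_mem_smul (Ideal.mem_span_singleton_self _) h3

theorem phiTEL_surjective [Finite X] (hlam : IsUnit lam) :
    Function.Surjective (phiTEL p lam X) := by
  suffices h : LinearMap.range (phiTEL p lam X).toLinearMap = ⊤ from
    LinearMap.range_eq_top.1 h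
  rw [eq_top_iff, ← span_word_eq_top, Submodule.span_le]
  rintro _ ⟨w, rfl⟩
  have := word_mem_degPart (lam := lam) w
  rw [← map_weightedHomogeneousSubmodule_eq hlam] at this
  exact LinearMap.map_le_range this

end TELIso

/-! ### Indecomposable elements -/

section Indecomposables

theorem mk_eq_zero_iff_mem_decomposables {k : Type*} [CommRing k] {lam : k} {X : Type*} {n : ℕ}
    (x : degPart lam X n) :
    (Submodule.Quotient.mk x : degPart lam X n ⧸
      (decomposables lam X n).submoduleOf (degPart lam X n)) = 0 ↔
      (x : Sh lam (FreeAbSemigroup X)) ∈ decomposables lam X n := by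
  rw [Submodule.Quotient.mk_eq_zero]
  rfl

variable {p : ℕ} [Fact p.Prime] {lam : ℤ_[p]} {X : Type*} [LinearOrder X]

theorem wordDeg_pos_of_mem_TEL (t : TEL p (FreeAbSemigroup X)) : 0 < wordDeg t.1 := by
  obtain ⟨_, e, he, i, rfl⟩ := t
  rw [wordDeg_tensorPow]
  exact Nat.mul_pos (pow_pos (Fact.out (p := p.Prime)).pos _) (wordDeg_pos he.1.1)

theorem coeff_zero_eq_zero {σ : Type*} {wt : σ → ℕ} {n : ℕ} (hn : n ≠ 0)
    {f : MvPolynomial σ ℤ_[p]} (hf : f.IsWeightedHomogeneous wt n) : f.coeff 0 = 0 :=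
  hf.coeff_eq_zero 0 (by rw [map_zero]; exact hn.symm)

theorem coeff_single_one_mul_eq_zero {σ R : Type*} [CommRing R] {f g : MvPolynomial σ R}
    (hf : f.coeff 0 = 0) (hg : g.coeff 0 = 0) (t : σ) :
    (f * g).coeff (Finsupp.single t 1) = 0 := by
  classical
  rw [coeff_mul]
  refine Finset.sum_eq_zero fun q hq => ?_
  rw [Finset.HasAntidiagonal.mem_antidiagonal] at hq
  have h := congrArg Finsupp.degree hq
  rw [map_add, Finsupp.degree_single] at h
  rcases Nat.eq_zero_or_pos q.1.degree with h1 | h1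
  · rw [(Finsupp.degree_eq_zero_iff _).1 h1, hf, zero_mul]
  · have h2 : q.2.degree = 0 := by omega
    rw [(Finsupp.degree_eq_zero_iff _).1 h2, hg, mul_zero]

/-- Decomposable elements are represented by polynomials without linear terms. -/
theorem coeff_single_one_eq_zero_of_mem_decomposables [Finite X] (hlam : IsUnit lam) {n : ℕ}
    {f : MvPolynomial (TEL p (FreeAbSemigroup X)) ℤ_[p]}
    (hf : phiTEL p lam X f ∈ decomposables lam X n) (t : TEL p (FreeAbSemigroup X)) :
    f.coeff (Finsupp.single t 1) = 0 := by
  have h : decomposables lam X n ≤ (LinearMap.ker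
      (lcoeff ℤ_[p] (Finsupp.single t 1))).map (phiTEL p lam X).toLinearMap := by
    refine iSup₂_le fun i hi => Submodule.mul_le.2 fun x hx y hy => ?_
    rw [Finset.mem_Ico] at hi
    rw [← map_weightedHomogeneousSubmodule_eq hlam] at hx hy
    obtain ⟨a, ha, rfl⟩ := hx
    obtain ⟨b, hb, rfl⟩ := hy
    refine ⟨a * b, ?_, map_mul (phiTEL p lam X) a b⟩
    exact coeff_single_one_mul_eq_zero (coeff_zero_eq_zero (by omega) ha)
      (coeff_zero_eq_zero (by omega) hb) t
  obtain ⟨g, hg, hgf⟩ := h hf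
  rw [← phiTEL_injective hlam hgf]
  exact hg

theorem phiTEL_mem_span_sup_decomposables {n : ℕ} (hn : n ≠ 0)
    {f : MvPolynomial (TEL p (FreeAbSemigroup X)) ℤ_[p]}
    (hf : f.IsWeightedHomogeneous (fun w => wordDeg w.1) n) :
    phiTEL p lam X f ∈ Submodule.span ℤ_[p]
      (Set.range fun w : TELDeg p X n => word lam w.1) ⊔ decomposables lam X n := by
  rw [f.as_sum, map_sum]
  refine Submodule.sum_mem _ fun μ hμ => ?_
  have hw := hf (mem_support_iff.1 hμ)
  rw [show monomial μ (f.coeff μ) = f.coeff μ • monomial μ 1 by rw [smul_monomial, smul_eq_mul,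
    mul_one], map_smul]
  refine Submodule.smul_mem _ _ ?_
  have hμ0 : μ ≠ 0 := by
    rintro rfl
    rw [map_zero] at hw
    exact hn hw.symm
  obtain ⟨t, ht⟩ := Finsupp.ne_iff.1 hμ0
  obtain ⟨ν, rfl⟩ : ∃ ν, μ = ν + Finsupp.single t 1 :=
    ⟨μ - Finsupp.single t 1, (Finsupp.sub_add_single_one_cancel ht).symm⟩
  rw [map_add, Finsupp.weight_single, one_smul] at hw
  by_cases hν : ν = 0
  · subst hν
    rw [map_zero, zero_add] at hw
    refine Submodule.mem_sup_left (Submodule.subset_span ⟨⟨t.1, t.2, hw⟩, ?_⟩)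
    rw [zero_add]
    exact (phiTEL_X t).symm
  · have hpos : 0 < Finsupp.weight (fun w : TEL p (FreeAbSemigroup X) => wordDeg w.1) ν := by
      obtain ⟨s, hs⟩ := Finsupp.ne_iff.1 hν
      have := Finsupp.le_weight (fun w : TEL p (FreeAbSemigroup X) => wordDeg w.1)
        (wordDeg_pos_of_mem_TEL s).ne' ν
      exact (Nat.pos_of_ne_zero hs).trans_le this
    have ht0 := wordDeg_pos_of_mem_TEL t
    refine Submodule.mem_sup_right ?_
    have h1 : monomial (ν + Finsupp.single t 1) (1 : ℤ_[p]) =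
        MvPolynomial.X t * monomial ν 1 := by
      rw [mul_comm, MvPolynomial.X, monomial_mul, one_mul]
    rw [h1, map_mul, phiTEL_X]
    refine (le_iSup₂_of_le (wordDeg t.1) (Finset.mem_Ico.2 ⟨ht0, by omega⟩) le_rfl :
      degPart lam X (wordDeg t.1) * degPart lam X (n - wordDeg t.1) ≤ decomposables lam X n)
      (Submodule.mul_mem_mul (word_mem_degPart t.1) (phiTEL_mem_degPart ?_))
    exact isWeightedHomogeneous_monomial _ _ _ (by omega)

theorem toIndecomposables_eq_mk (n : ℕ) (g : TELDeg p X n →₀ ℤ_[p]) :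
    ∃ h, toIndecomposables p lam X n g = Submodule.Quotient.mk
      ⟨Finsupp.linearCombination ℤ_[p] (fun w : TELDeg p X n => word lam w.1) g, h⟩ := by
  induction g using Finsupp.induction_linear with
  | zero =>
    refine ⟨by rw [map_zero]; exact Submodule.zero_mem _, ?_⟩
    rw [map_zero]
    symm
    rw [Submodule.Quotient.mk_eq_zero]
    convert Submodule.zero_mem _
    simp
  | add f g hf hg =>
    obtain ⟨hf, hf'⟩ := hf
    obtain ⟨hg, hg'⟩ := hg
    refine ⟨by rw [map_add]; exact Submodule.add_mem _ hf hg, ?_⟩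
    rw [map_add, hf', hg', ← Submodule.Quotient.mk_add]
    congr 1
    exact Subtype.ext (map_add _ _ _).symm
  | single w c =>
    refine ⟨?_, ?_⟩
    · rw [Finsupp.linearCombination_single]
      exact Submodule.smul_mem _ _ (Submodule.subset_span ⟨w.1, w.2.2, rfl⟩)
    · rw [toIndecomposables, Finsupp.linearCombination_single, ← Submodule.Quotient.mk_smul]
      congr 1
      refine Subtype.ext ?_
      change c • word lam w.1 = Finsupp.linearCombination ℤ_[p] _ (Finsupp.single w c)
      rw [Finsupp.linearCombination_single]

theorem bijective_toIndecomposables [Finite X] (hlam : IsUnit lam) {n : ℕ} (hn : n ≠ 0) :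
    Function.Bijective (toIndecomposables p lam X n) := by
  refine ⟨(injective_iff_map_eq_zero _).2 fun g hg => ?_, fun x => ?_⟩
  · obtain ⟨h, h'⟩ := toIndecomposables_eq_mk (lam := lam) n g
    rw [h', mk_eq_zero_iff_mem_decomposables] at hg
    set ι : TELDeg p X n → TEL p (FreeAbSemigroup X) := fun w => ⟨w.1, w.2.1⟩ with hι
    have hinj : Function.Injective ι := fun w w' hw =>
      Subtype.ext (congrArg (fun t : TEL p (FreeAbSemigroup X) => t.1) hw)
    have h1 : phiTEL p lam X (Finsupp.linearCombination ℤ_[p]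
        (fun w => (MvPolynomial.X (ι w) : MvPolynomial _ ℤ_[p])) g) =
        Finsupp.linearCombination ℤ_[p] (fun w : TELDeg p X n => word lam w.1) g := by
      rw [Finsupp.linearCombination_apply, Finsupp.linearCombination_apply, map_finsuppSum]
      refine Finsupp.sum_congr fun w _ => ?_
      rw [map_smul, phiTEL_X]
    change Finsupp.linearCombination ℤ_[p] (fun w : TELDeg p X n => word lam w.1) g ∈ _ at hg
    rw [← h1] at hg
    ext w
    have h2 := coeff_single_one_eq_zero_of_mem_decomposables hlam hg (ι w)
    rw [Finsupp.linearCombination_apply, Finsupp.sum, coeff_sum] at h2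
    classical
    simp only [coeff_smul, coeff_X, smul_eq_mul, mul_ite, mul_one, mul_zero,
      Finsupp.single_left_inj (one_ne_zero : (1 : ℕ) ≠ 0), hinj.eq_iff,
      Finset.sum_ite_eq', Finsupp.mem_support_iff] at h2
    simpa using h2
  · obtain ⟨⟨x, hx⟩, rfl⟩ := Submodule.Quotient.mk_surjective _ x
    have hx' := hx
    rw [← map_weightedHomogeneousSubmodule_eq hlam] at hx'
    obtain ⟨f, hf, rfl⟩ := hx'
    obtain ⟨s, hs, d, hd, hsd⟩ :=
      Submodule.mem_sup.1 (phiTEL_mem_span_sup_decomposables (lam := lam) hn hf)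
    obtain ⟨g, rfl⟩ := Finsupp.mem_span_range_iff_exists_finsupp.1 hs
    obtain ⟨h, h'⟩ := toIndecomposables_eq_mk (lam := lam) n g
    refine ⟨g, ?_⟩
    rw [h', ← sub_eq_zero, ← Submodule.Quotient.mk_sub, mk_eq_zero_iff_mem_decomposables]
    have h2 : (Finsupp.linearCombination ℤ_[p] (fun w : TELDeg p X n => word lam w.1) g) -
        phiTEL p lam X f = -d := by
      rw [← hsd, Finsupp.linearCombination_apply]
      abel
    change (Finsupp.linearCombination ℤ_[p] (fun w : TELDeg p X n => word lam w.1) g) -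
        phiTEL p lam X f ∈ _
    rw [h2]
    exact Submodule.neg_mem _ hd

end Indecomposables

end MixShuffle

end

theorem mainTheorem5 (p : ℕ) [Fact p.Prime] (lam : ℤ_[p]) (hlam : IsUnit lam) :
    (∀ (X : Type*) [Finite X] [LinearOrder X],
      SetLike.GradedMonoid (MixShuffle.degPart lam X) ∧
      DirectSum.IsInternal (MixShuffle.degPart lam X) ∧
      Function.Bijective (MixShuffle.phiTEL p lam X) ∧
      (∀ n : ℕ,
        (MvPolynomial.weightedHomogeneousSubmodule ℤ_[p]
          (fun w : MixShuffle.TEL p (MixShuffle.FreeAbSemigroup X) =>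
            MixShuffle.wordDeg w.1) n).map (MixShuffle.phiTEL p lam X).toLinearMap =
          MixShuffle.degPart lam X n) ∧
      (∀ n : ℕ, 1 ≤ n →
        MixShuffle.decomposables lam X n ≤ MixShuffle.degPart lam X n ∧
        Function.Bijective (MixShuffle.toIndecomposables p lam X n) ∧
        (MixShuffle.LynDeg X n).Finite ∧ (MixShuffle.TELDeg p X n).Finite ∧
        (MixShuffle.TELDeg p X n).ncard = (MixShuffle.LynDeg X n).ncard)) ∧
    (∀ (S : Type*) [CommSemigroup S] [LinearOrder S], MixShuffle.IsClassJ p S →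
      (∃ Q₁ Q₂, MixShuffle.IsLift (p := p) (lam := lam) (S := S) Q₁ Q₂) ∧
      (∀ Q₁ Q₂, MixShuffle.IsLift (p := p) (lam := lam) (S := S) Q₁ Q₂ →
        ∃ h : ∀ a ∈ MixShuffle.padicClosure p (MixShuffle.relIdeal Q₁ Q₂),
            MixShuffle.phiEETL p lam S a = 0,
          Function.Bijective
            (Ideal.Quotient.liftₐ (MixShuffle.padicClosure p (MixShuffle.relIdeal Q₁ Q₂))
              (MixShuffle.phiEETL p lam S) h))) := by
  refine ⟨fun X _ _ => ⟨MixShuffle.gradedMonoid_degPart, MixShuffle.isInternal_degPart,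
    ⟨MixShuffle.phiTEL_injective hlam, MixShuffle.phiTEL_surjective hlam⟩,
    MixShuffle.map_weightedHomogeneousSubmodule_eq hlam, fun n hn =>
    ⟨MixShuffle.decomposables_le n, MixShuffle.bijective_toIndecomposables hlam (by omega),
      (MixShuffle.finite_setOf_wordDeg_eq n).subset fun _ h => h.2,
      (MixShuffle.finite_setOf_wordDeg_eq n).subset fun _ h => h.2,
      MixShuffle.ncard_TELDeg_eq n⟩⟩, fun S _ _ hS =>
    ⟨hS.exists_isLift hlam, fun Q₁ Q₂ hQ => hS.exists_bijective_liftₐ hQ⟩⟩
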